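/- **Setting.** For a finite-dimensional Hilbert space $\mathcal H$ (for instance $N$ qubits) a *Lindbladian* is a linear map $\mathcal L$ on $\mathcal B(\mathcal H)$ such that $e^{t\mathcal L}$ is completely positive and trace preserving for every $t\ge 0$. Let $\|T\|_{1\to1}=\sup_{Y\ne0}\|T(Y)\|_1/\|Y\|_1$ be the norm induced by the trace norm. Fix constants $t,\delta,C_G>0$ and put $L_0=t\,\delta\,C_G$. An *ensemble with $M$ parameters* consists of a finite-dimensional $\mathcal H$, a reference Lindbladian $\mathcal L_{\rm ref}$, linear maps $G_1,\dots,G_M$ on $\mathcal B(\mathcal H)$ with $\|G_j\|_{1\to1}\le C_G$, a measurable set $\Theta\subseteq S^{M-1}$ of positive surface measure such that $$\mathcal L(\theta)=\mathcal L_{\rm ref}+\frac{\delta}{\sqrt M}\sum_{j=1}^M\theta_jG_j$$ is a Lindbladian for all $\theta\in\Theta$, an input state $\rho_{\rm in}$, and a POVM $\{M_x\}_{x\in X}$ with finite outcome set $X$. Let $\mu_\Theta$ be the normalized restriction of the surface measure to $\Theta$, and let $\mu_{\mathcal L}$ be the law of $\mathcal L(\theta)$ for $\theta\sim\mu_\Theta$.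 Put $P_{\mathcal L}(x)=\operatorname{Tr}(M_x\,e^{t\mathcal L}(\rho_{\rm in}))$, let $Q=\mathbb E_{\mathcal L\sim\mu_{\mathcal L}}P_{\mathcal L}$ be the ensemble average, and let $d_{\rm TV}(P,P')=\frac12\sum_x|P(x)-P'(x)|$. *Lévy concentration with constant $\kappa>0$:* for every $s>0$ and every $K$-Lipschitz $f:\Theta\to\mathbb R$ (Euclidean distance, $K>0$), $\mu_\Theta(|f-\mathbb E f|\ge s)\le 2\exp(-\kappa M s^2/K^2)$. *Mean assumption with $m_0>0$ and $\epsilon_{\rm mean}(M)$:* $\big|\mathbb E_{\mathcal L\sim\mu_{\mathcal L}}\,d_{\rm TV}(P_{\mathcal L},Q)-m_0\big|\le\epsilon_{\rm mean}(M)$. *SQ learning:* for a query $\varphi:X\to[-1,1]$ a valid oracle $\mathrm{Stat}_\tau(P)$ returns a number within $\tau$ of $P[\varphi]=\sum_x\varphi(x)P(x)$. An SQ algorithm chooses its queries adaptively and without computational restrictions, and then outputs a distribution $\widehat P$ on $X$. A deterministic algorithm *$\epsilon$-learns $P$ within $q$ queries* if, for every valid oracle, it makes at most $q$ queries and $d_{\rm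 TV}(\widehat P,P)<\epsilon$. A randomized algorithm (a random deterministic algorithm, measurable in its random seed) *does so with probability at least $\alpha$* if, for every fixed measurable valid oracle, this event has probability at least $\alpha$ over its seed. **Theorem.** (a) There is an absolute constant $\kappa>0$ such that, for all $M\ge1$, Lévy concentration with constant $\kappa$ holds for every measurable $\Theta\subseteq S^{M-1}$ of full surface measure. (b) Let $t,\delta,C_G,\kappa,m_0>0$, let $\epsilon_{\rm mean}(M)\to0$ as $M\to\infty$, and let $\epsilon,\tau>0$ with $2\epsilon+\tau<m_0$, $\alpha>\tfrac12$ and $\beta>0$. Put $c=\kappa\tau^2/L_0^2$. Then there is $M_0$, depending only on these constants and on the sequence $\epsilon_{\rm mean}$, such that the following holds for every $M\ge M_0$ and every ensemble with $M$ parameters that satisfies Lévy concentration with constant $\kappa$ and the mean assumption with $m_0$ and $\epsilon_{\rm mean}(M)$. 1. If a deterministic SQ algorithm $\epsilon$-learns $P_{\mathcal L}$ within $q$ queries of tolerance $\tau$ on a set of Lindbladians $\mathcal L$ of $\mu_{\mathcal L}$-measure at least $\beta$, then $q\ge\frac18\,\beta\,e^{cM}$. 2. If a randomized SQ algorithm,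 on a set of Lindbladians $\mathcal L$ of $\mu_{\mathcal L}$-measure at least $\beta$, $\epsilon$-learns $P_{\mathcal L}$ within $q$ queries of tolerance $\tau$ with probability at least $\alpha$ over its internal randomness, then $q\ge\frac18\,(\alpha-\tfrac12)\,\beta\,e^{cM}$. -/

import Mathlib

open MeasureTheory Filter Topology
open scoped ENNReal NNReal ComplexOrder

/-! ### Superoperators, Lindbladians, trace norm -/

/-- Superoperators: linear maps `B(H) → B(H)` for `H = ℂⁿ`. -/
abbrev SuperOp (n : Type*) [Fintype n] : Type _ := Module.End ℂ (Matrix n n ℂ)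

/-- The trace norm `‖A‖₁ = Tr √(A† A)`, the sum of the singular values of `A`. -/
noncomputable def traceNorm {n : Type*} [Fintype n] [DecidableEq n] (A : Matrix n n ℂ) : ℝ :=
  ∑ i, Real.sqrt ((Matrix.isHermitian_conjTranspose_mul_self A).eigenvalues i)

/-- The induced norm `‖T‖_{1→1} = sup_{Y ≠ 0} ‖T Y‖₁ / ‖Y‖₁`, as an extended nonnegative real. -/
noncomputable def oneToOneNorm {n : Type*} [Fintype n] [DecidableEq n] (T : SuperOp n) : ℝ≥0∞ :=
  ⨆ (Y : Matrix n n ℂ) (_ : Y ≠ 0), ENNReal.ofReal (traceNorm (T Y) / traceNorm Y)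

/-- The map `T ⊗ id_k` on operators of `ℂⁿ ⊗ ℂᵏ`. -/
def ampliation {n : Type*} [Fintype n] (T : SuperOp n) (k : ℕ)
    (Y : Matrix (n × Fin k) (n × Fin k) ℂ) : Matrix (n × Fin k) (n × Fin k) ℂ :=
  Matrix.of fun p q => T (Matrix.of fun i j => Y (i, p.2) (j, q.2)) p.1 q.1

/-- Completely positive and trace preserving. -/
structure IsCPTP {n : Type*} [Fintype n] (T : SuperOp n) : Prop where
  completelyPositive : ∀ (k : ℕ) (Y : Matrix (n × Fin k) (n × Fin k) ℂ),
    Y.PosSemidef → (ampliation T k Y).PosSemidef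
  tracePreserving : ∀ Y : Matrix n n ℂ, (T Y).trace = Y.trace

/-- The element `Λ_t = e^{tL}` of the semigroup generated by `L`. The exponential is computed by
representing superoperators as matrices in the standard basis of matrix units. -/
noncomputable def semigroup {n : Type*} [Fintype n] [DecidableEq n] (L : SuperOp n) (t : ℝ) :
    SuperOp n :=
  (LinearMap.toMatrixAlgEquiv (Matrix.stdBasis ℂ n n)).symm
    (NormedSpace.exp ((t : ℂ) • LinearMap.toMatrixAlgEquiv (Matrix.stdBasis ℂ n n) L))

/-- `L` is a GKSL generator (Lindbladian): `e^{tL}`, `t ≥ 0`, is a semigroup of CPTP maps. -/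
def IsLindbladian {n : Type*} [Fintype n] [DecidableEq n] (L : SuperOp n) : Prop :=
  ∀ t : ℝ, 0 ≤ t → IsCPTP (semigroup L t)

/-! ### Finite distributions and the statistical query model -/

/-- The total variation distance on a finite set. -/
noncomputable def tvDist {X : Type*} [Fintype X] (P Q : X → ℝ) : ℝ :=
  (1 / 2) * ∑ x, |P x - Q x|

/-- Query functions `φ : X → [-1, 1]`. -/
abbrev Query (X : Type*) : Type _ := {φ : X → ℝ // ∀ x, φ x ∈ Set.Icc (-1 : ℝ) 1}

/-- `P[φ]`, the expectation of `φ` under `P`. -/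
def expect {X : Type*} [Fintype X] (P : X → ℝ) (φ : Query X) : ℝ :=
  ∑ x, φ.1 x * P x

/-- `O` is a statistical query oracle `Stat_τ(P)`. -/
def IsStatOracle {X : Type*} [Fintype X] (τ : ℝ) (P : X → ℝ) (O : Query X → ℝ) : Prop :=
  ∀ φ : Query X, |O φ - expect P φ| ≤ τ

/-- A deterministic (adaptive, computationally unbounded) SQ learning algorithm: from the answers
to its first `k` queries it computes either its next query or its final hypothesis, which is a
probability distribution on `X`. -/
abbrev SQAlgorithm (X : Type*) [Fintype X] : Type _ :=
  (k : ℕ) → (Fin k → ℝ) → Query X ⊕ stdSimplex ℝ X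

/-- Run `A` with oracle `O`, starting after the `k` answers `h`, for at most `q` further queries.
The value is the hypothesis, or `none` if `A` wants to make more than `q` further queries. -/
def SQAlgorithm.run {X : Type*} [Fintype X] (A : SQAlgorithm X) (O : Query X → ℝ) :
    (q k : ℕ) → (Fin k → ℝ) → Option (stdSimplex ℝ X)
  | 0, k, h =>
    match A k h with
    | Sum.inl _ => none
    | Sum.inr P => some P
  | q + 1, k, h =>
    match A k h with
    | Sum.inl φ => SQAlgorithm.run A O q (k + 1) (Fin.snoc h (O φ))
    | Sum.inr P => some P

/-- With oracle `O`, `A` makes at most `q` queries and outputs a distribution at total variation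
distance less than `ε` from `P`. -/
def SQAlgorithm.Succeeds {X : Type*} [Fintype X] (A : SQAlgorithm X) (O : Query X → ℝ)
    (ε : ℝ) (q : ℕ) (P : X → ℝ) : Prop :=
  ∃ Phat : stdSimplex ℝ X, SQAlgorithm.run A O q 0 Fin.elim0 = some Phat ∧ tvDist Phat.1 P < ε

/-- The deterministic algorithm `A` `ε`-learns `P` within `q` queries of tolerance `τ`, whatever
valid oracle it is given. -/
def SQAlgorithm.Learns {X : Type*} [Fintype X] (A : SQAlgorithm X) (ε τ : ℝ) (q : ℕ)
    (P : X → ℝ) : Prop :=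
  ∀ O : Query X → ℝ, IsStatOracle τ P O → SQAlgorithm.Succeeds A O ε q P

/-- A randomized SQ learning algorithm with random seed in `Ω`: a deterministic algorithm for each
seed, with jointly measurable dependence on the seed and on the answers received. -/
structure RandomizedSQAlgorithm (Ω X : Type*) [MeasurableSpace Ω] [Fintype X] where
  alg : Ω → SQAlgorithm X
  measurable_alg : ∀ k : ℕ, Measurable fun p : Ω × (Fin k → ℝ) => alg p.1 k p.2

/-- With probability at least `α` over its seed, the randomized algorithm `A` `ε`-learns `P` within
`q` queries of tolerance `τ`. It is only asked to do so for oracles that answer each query in a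
fixed way that does not depend on the seed. -/
def RandomizedSQAlgorithm.Learns {Ω X : Type*} [MeasurableSpace Ω] [Fintype X]
    (A : RandomizedSQAlgorithm Ω X) (ℙ : Measure Ω) (α ε τ : ℝ) (q : ℕ) (P : X → ℝ) : Prop :=
  ∀ O : Query X → ℝ, Measurable O → IsStatOracle τ P O →
    α ≤ ℙ.real {ω | SQAlgorithm.Succeeds (A.alg ω) O ε q P}

/-! ### The parameter sphere and the random Lindbladian ensemble -/

/-- The unit sphere `S^{M-1}` of `ℝ^M` with the Euclidean metric. -/
abbrev ParamSphere (M : ℕ) : Type := Metric.sphere (0 : EuclideanSpace ℝ (Fin M)) 1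

/-- The (unnormalized) rotation invariant surface measure on `S^{M-1}`. -/
noncomputable def surfaceMeasure (M : ℕ) : Measure (ParamSphere M) :=
  (volume : Measure (EuclideanSpace ℝ (Fin M))).toSphere

/-- The uniform probability measure on `Θ ⊆ S^{M-1}`: the normalized restriction of the surface
measure to `Θ`. -/
noncomputable def uniformOn {M : ℕ} (Θ : Set (ParamSphere M)) : Measure (ParamSphere M) :=
  ProbabilityTheory.cond (surfaceMeasure M) Θ

/-- Lévy concentration with constant `κ` on `Θ ⊆ S^{M-1}` with the Euclidean metric and the uniform
measure: `Pr(|f - 𝔼 f| ≥ s) ≤ 2 exp(-κ M s² / K²)` for every `K`-Lipschitz `f : Θ → ℝ`. -/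
def LevyConcentration {M : ℕ} (κ : ℝ) (Θ : Set (ParamSphere M)) : Prop :=
  ∀ (f : ParamSphere M → ℝ) (K : ℝ≥0), 0 < K → LipschitzOnWith K f Θ → ∀ s : ℝ, 0 < s →
    (uniformOn Θ).real {θ | s ≤ |f θ - ∫ θ', f θ' ∂(uniformOn Θ)|} ≤
      2 * Real.exp (-(κ * M * s ^ 2 / (K : ℝ) ^ 2))

/-- A parameter-sphere ensemble of Lindbladians on `ℂⁿ` (for `N` qubits, `n` has `2^N` elements)
with `M` parameters, perturbation strength `δ` and bound `C_G` on the directions, together with the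
interface (input state and POVM) through which it is observed. -/
structure LindbladianEnsemble (n X : Type*) [Fintype n] [DecidableEq n] [Fintype X]
    (M : ℕ) (δ C_G : ℝ) where
  /-- the reference generator -/
  Lref : SuperOp n
  lindbladian_Lref : IsLindbladian Lref
  /-- the directions -/
  G : Fin M → SuperOp n
  norm_G_le : ∀ j, oneToOneNorm (G j) ≤ ENNReal.ofReal C_G
  /-- the admissible parameters -/
  Θ : Set (ParamSphere M)
  measurableSet_Θ : MeasurableSet Θ
  surfaceMeasure_Θ_ne_zero : surfaceMeasure M Θ ≠ 0
  lindbladian_of_mem : ∀ θ ∈ Θ, IsLindbladian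
    (Lref + ((δ / Real.sqrt M : ℝ) : ℂ) • ∑ j, ((θ.1 j : ℝ) : ℂ) • G j)
  /-- the input state -/
  ρ : Matrix n n ℂ
  posSemidef_ρ : ρ.PosSemidef
  trace_ρ : ρ.trace = 1
  /-- the POVM -/
  povm : X → Matrix n n ℂ
  posSemidef_povm : ∀ x, (povm x).PosSemidef
  sum_povm : ∑ x, povm x = 1

namespace LindbladianEnsemble

variable {n X : Type*} [Fintype n] [DecidableEq n] [Fintype X] {M : ℕ} {δ C_G : ℝ}

/-- `L(θ) = L_ref + (δ / √M) ∑ⱼ θⱼ Gⱼ`. -/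
noncomputable def L (E : LindbladianEnsemble n X M δ C_G) (θ : ParamSphere M) : SuperOp n :=
  E.Lref + ((δ / Real.sqrt M : ℝ) : ℂ) • ∑ j, ((θ.1 j : ℝ) : ℂ) • E.G j

/-- The law `μ_Θ` of the parameter. Drawing `L` from the ensemble means drawing `θ` from `μ_Θ` and
taking `L = L(θ)`. -/
noncomputable def μ (E : LindbladianEnsemble n X M δ C_G) : Measure (ParamSphere M) :=
  uniformOn E.Θ

/-- The output distribution `P_{L(θ)}(x) = Tr(M_x e^{t L(θ)}(ρ))` at time `t`. -/
noncomputable def outDist (E : LindbladianEnsemble n X M δ C_G) (t : ℝ) (θ : ParamSphere M) :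
    X → ℝ :=
  fun x => (E.povm x * semigroup (E.L θ) t E.ρ).trace.re

/-- The ensemble average `Q` of the output distributions. -/
noncomputable def avgDist (E : LindbladianEnsemble n X M δ C_G) (t : ℝ) : X → ℝ :=
  fun x => ∫ θ, E.outDist t θ x ∂E.μ

/-- The mean total variation distance `𝔼 d_TV(P_L, Q)` to the ensemble average. -/
noncomputable def meanTV (E : LindbladianEnsemble n X M δ C_G) (t : ℝ) : ℝ :=
  ∫ θ, tvDist (E.outDist t θ) (E.avgDist t) ∂E.μ

end LindbladianEnsemble

/-! ### Dimension-free concentration for standard Gaussian vectors -/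

section GaussianConcentration

open ProbabilityTheory Real
open scoped RealInnerProductSpace

variable {E : Type*} [NormedAddCommGroup E] [InnerProductSpace ℝ E] [FiniteDimensional ℝ E]
  [MeasurableSpace E] [BorelSpace E]

/-! Part (a) comes from Gaussian concentration. Two independent Gaussian vectors are joined by a
quarter circle of rotations, and Jensen's inequality along it bounds the Laplace transform of `F y -
F x` by that of `(π / 2) * F'(x) y`, which is Gaussian in `y` with variance at most `(π K / 2) ^ 2`
(`LipschitzWith.integral_exp_mul_sub_stdGaussian_le`). A centred function on the sphere is extended
homogeneously of degree one. Direction and norm of a Gaussian vector are independent, so the norm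
can be replaced by its mean, which is at least a constant times `√M`
(`LipschitzWith.average_exp_sphere_le`, `gaussianAbsMoment_mul_sqrt_le`).

For part (b), Duhamel's formula differentiates `e^{(t-s)L} e^{sL'}`. The left factor acts dually on
an observable in `[-1, 1]` and keeps it there, the right factor keeps states states, and so a query
value is `L₀`-Lipschitz in `θ`: the `1 / √M` in the ensemble cancels the Cauchy–Schwarz loss. Each
fixed query therefore separates `P_L` from `Q` by more than `τ` with probability at most `η = 2
e^{-cM}`, and each fixed hypothesis is `ε`-close to `P_L` with probability at most `η`
(`LindbladianEnsemble.measureReal_ball_le`).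

An oracle may answer with the values of `Q` until a query separates `P_L` from `Q`. Up to that
moment the algorithm sees nothing of `L`, so its queries and hypothesis are those of one fixed run.
A union bound over `q` queries and one hypothesis limits the learnable set to measure `(q + 1) η`. A
randomized algorithm reduces to this seed by seed, through Tonelli and Markov. -/

theorem integrable_exp_neg_half_sq_norm :
    Integrable (fun x : E ↦ rexp (-(1 / 2) * ‖x‖ ^ 2)) := by
  have := (GaussianFourier.integrable_cexp_neg_mul_sq_norm_add (V := E) (b := ((1 / 2 : ℝ) : ℂ))
    (by norm_num) 0 0).re
  convert this using 2 with x
  have : (-((1 / 2 : ℝ) : ℂ) * (‖x‖ : ℂ) ^ 2 + 0 * ((⟪(0 : E), x⟫ : ℝ) : ℂ))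
    = ((-(1 / 2) * ‖x‖ ^ 2 : ℝ) : ℂ) := by push_cast; ring
  rw [this, ← Complex.ofReal_exp]
  rfl

/-- Finite measures are determined by their characteristic functions, and that of the density is a
Gaussian integral. The radial form of the density is what allows polar coordinates later. -/
theorem exists_stdGaussian_eq_withDensity : ∃ c : ℝ, 0 < c ∧
    stdGaussian E = volume.withDensity
      (fun x ↦ ENNReal.ofReal (c * rexp (-(1 / 2) * ‖x‖ ^ 2))) := by
  set c : ℝ := (∫ x : E, rexp (-(1 / 2) * ‖x‖ ^ 2))⁻¹ with hc
  have hpos : 0 < ∫ x : E, rexp (-(1 / 2) * ‖x‖ ^ 2) := by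
    rw [GaussianFourier.integral_rexp_neg_mul_sq_norm (by norm_num)]
    positivity
  have hc0 : 0 < c := inv_pos.2 hpos
  refine ⟨c, hc0, ?_⟩
  have hint : Integrable (fun x : E ↦ c * rexp (-(1 / 2) * ‖x‖ ^ 2)) :=
    integrable_exp_neg_half_sq_norm.const_mul c
  have : IsFiniteMeasure ((volume : Measure E).withDensity
      (fun x ↦ ENNReal.ofReal (c * rexp (-(1 / 2) * ‖x‖ ^ 2)))) :=
    isFiniteMeasure_withDensity_ofReal hint.2
  apply Measure.ext_of_charFun
  ext t
  rw [charFun_stdGaussian, charFun_apply, integral_withDensity_eq_integral_toReal_smul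
    (by fun_prop) (by simp)]
  have h1 : ∀ x : E, (ENNReal.ofReal (c * rexp (-(1 / 2) * ‖x‖ ^ 2))).toReal •
      Complex.exp (⟪x, t⟫ * Complex.I) = (c : ℂ) *
      Complex.exp (-((1 / 2 : ℝ) : ℂ) * (‖x‖ : ℂ) ^ 2 + Complex.I * ⟪t, x⟫) := by
    intro x
    rw [ENNReal.toReal_ofReal (by positivity), Complex.real_smul, Complex.exp_add,
      real_inner_comm]
    push_cast
    ring_nf
  simp_rw [h1]
  rw [integral_const_mul, GaussianFourier.integral_cexp_neg_mul_sq_norm_add (by norm_num)]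
  have h2 : (c : ℂ) * ((π : ℂ) / ((1 / 2 : ℝ) : ℂ)) ^ (Module.finrank ℝ E / 2 : ℂ) = 1 := by
    have h3 := GaussianFourier.integral_rexp_neg_mul_sq_norm (V := E) (b := 1 / 2) (by norm_num)
    have h4 : (((π / (1 / 2)) ^ (Module.finrank ℝ E / 2 : ℝ) : ℝ) : ℂ) =
      ((π : ℂ) / ((1 / 2 : ℝ) : ℂ)) ^ (Module.finrank ℝ E / 2 : ℂ) := by
      rw [Complex.ofReal_cpow (by positivity)]
      push_cast
      rfl
    rw [← h4, ← h3, hc, ← Complex.ofReal_mul, inv_mul_cancel₀ hpos.ne', Complex.ofReal_one]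
  rw [← mul_assoc, h2, one_mul]
  congr 1
  push_cast
  rw [Complex.I_sq]
  ring

theorem stdGaussian_absolutelyContinuous : stdGaussian E ≪ (volume : Measure E) := by
  obtain ⟨c, -, h⟩ := exists_stdGaussian_eq_withDensity (E := E)
  rw [h]
  exact withDensity_absolutelyContinuous _ _

/-- Fernique's theorem gives an integrable `exp (a * ‖x‖ ^ 2)`, and completing the square dominates
the linear exponent by it. -/
theorem integrable_exp_mul_norm_stdGaussian (C : ℝ) :
    Integrable (fun x : E ↦ rexp (C * ‖x‖)) (stdGaussian E) := by
  obtain ⟨a, ha, hint⟩ := IsGaussian.exists_integrable_exp_sq (stdGaussian E)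
  refine (hint.const_mul (rexp (C ^ 2 / (4 * a)))).mono' (by fun_prop) (ae_of_all _ fun x ↦ ?_)
  rw [Real.norm_eq_abs, abs_of_pos (exp_pos _), ← Real.exp_add]
  apply Real.exp_le_exp.2
  have : C ^ 2 / (4 * a) + a * ‖x‖ ^ 2 - C * ‖x‖ = a * (‖x‖ - C / (2 * a)) ^ 2 := by
    field_simp
    ring
  nlinarith [mul_nonneg ha.le (sq_nonneg (‖x‖ - C / (2 * a)))]

theorem integral_exp_mul_strongDual_stdGaussian (L : StrongDual ℝ E) (t : ℝ) :
    ∫ x, rexp (t * L x) ∂(stdGaussian E) = rexp (t ^ 2 * ‖L‖ ^ 2 / 2) := by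
  have h := mgf_gaussianReal (IsGaussian.map_eq_gaussianReal (μ := stdGaussian E) L) t
  rw [mgf] at h
  rw [h, integral_strongDual_stdGaussian, variance_dual_stdGaussian,
    Real.coe_toNNReal _ (by positivity)]
  ring_nf

omit [FiniteDimensional ℝ E] [MeasurableSpace E] [BorelSpace E] in
/-- Increments of a Lipschitz function between successive points of a rotated pair. -/
theorem abs_sub_le_of_lipschitz_rotation {F : E → ℝ} {K : ℝ≥0} (hF : LipschitzWith K F)
    {h : ℝ} (hh : 0 ≤ h) (x y : E) :
    |F (cos h • x + sin h • y) - F x| ≤ K * (h * (‖x‖ + ‖y‖)) := by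
  have h1 : |cos h - 1| ≤ h := by
    have := Real.abs_cos_sub_cos_le h 0
    simpa [abs_of_nonneg hh] using this
  have h2 : |sin h| ≤ h := by
    have := Real.abs_sin_sub_sin_le h 0
    simpa [abs_of_nonneg hh] using this
  calc |F (cos h • x + sin h • y) - F x| ≤ K * ‖(cos h • x + sin h • y) - x‖ := by
        simpa [Real.dist_eq, dist_eq_norm] using hF.dist_le_mul (cos h • x + sin h • y) x
    _ = K * ‖(cos h - 1) • x + sin h • y‖ := by congr 2; module
    _ ≤ K * (h * ‖x‖ + h * ‖y‖) := by
        gcongr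
        refine (norm_add_le _ _).trans ?_
        rw [norm_smul, norm_smul, Real.norm_eq_abs, Real.norm_eq_abs]
        gcongr
    _ = _ := by ring

theorem integrable_exp_mul_norm_add_norm_prod_stdGaussian (C : ℝ) :
    Integrable (fun p : E × E ↦ rexp (C * (‖p.1‖ + ‖p.2‖)))
      ((stdGaussian E).prod (stdGaussian E)) := by
  simp_rw [mul_add, Real.exp_add]
  exact (integrable_exp_mul_norm_stdGaussian C).mul_prod (integrable_exp_mul_norm_stdGaussian C)

theorem LipschitzWith.integrable_exp_rotation_increment {F : E → ℝ} {K : ℝ≥0}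
    (hF : LipschitzWith K F) {h : ℝ} (hh : 0 ≤ h) (l : ℝ) :
    Integrable (fun p : E × E ↦ rexp (l * (F (cos h • p.1 + sin h • p.2) - F p.1)))
      ((stdGaussian E).prod (stdGaussian E)) := by
  have hc := hF.continuous
  refine (integrable_exp_mul_norm_add_norm_prod_stdGaussian (|l| * (K * h))).mono'
    (by fun_prop) (ae_of_all _ fun p ↦ ?_)
  rw [Real.norm_eq_abs, abs_of_pos (exp_pos _)]
  apply Real.exp_le_exp.2
  refine (le_abs_self _).trans ?_
  rw [abs_mul, mul_assoc, mul_assoc]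
  gcongr
  exact abs_sub_le_of_lipschitz_rotation hF hh p.1 p.2

/-- The quarter circle from `p.1` to `p.2` is cut into `n` equal arcs. The increment telescopes,
convexity of `exp` bounds its exponential by the average over the arcs, and rotation invariance of
the product Gaussian makes all arcs contribute equally. -/
theorem LipschitzWith.integral_exp_sub_le_rotation_increment {F : E → ℝ} {K : ℝ≥0}
    (hF : LipschitzWith K F) (l : ℝ) {n : ℕ} (hn : n ≠ 0) :
    ∫ p : E × E, rexp (l * (F p.2 - F p.1)) ∂((stdGaussian E).prod (stdGaussian E)) ≤
      ∫ p : E × E, rexp (l * n * (F (cos (π / (2 * n)) • p.1 + sin (π / (2 * n)) • p.2) - F p.1))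
        ∂((stdGaussian E).prod (stdGaussian E)) := by
  have hc := hF.continuous
  have hn' : (n : ℝ) ≠ 0 := by exact_mod_cast hn
  set h : ℝ := π / (2 * n) with hh
  have hh0 : 0 ≤ h := by positivity
  set Ψ : E × E → ℝ := fun p ↦ rexp (l * n * (F (cos h • p.1 + sin h • p.2) - F p.1)) with hΨ
  have hΨc : Continuous Ψ := by fun_prop
  have hΨi : Integrable Ψ ((stdGaussian E).prod (stdGaussian E)) :=
    hF.integrable_exp_rotation_increment hh0 (l * n)
  have hrot : ∀ θ : ℝ, ((stdGaussian E).prod (stdGaussian E)).map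
      (ContinuousLinearMap.rotation θ) = (stdGaussian E).prod (stdGaussian E) := fun θ ↦
    IsGaussian.map_rotation_eq_self (by simp) θ
  have hΨrot : ∀ θ : ℝ, ∫ p, Ψ (ContinuousLinearMap.rotation θ p)
      ∂((stdGaussian E).prod (stdGaussian E)) =
      ∫ p, Ψ p ∂((stdGaussian E).prod (stdGaussian E)) := by
    intro θ
    conv_rhs => rw [← hrot θ]
    rw [integral_map (by fun_prop) hΨc.aestronglyMeasurable]
  have hΨroti : ∀ θ : ℝ, Integrable (fun p ↦ Ψ (ContinuousLinearMap.rotation θ p))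
      ((stdGaussian E).prod (stdGaussian E)) := by
    intro θ
    have : Integrable Ψ (((stdGaussian E).prod (stdGaussian E)).map
      (ContinuousLinearMap.rotation θ)) := by rwa [hrot θ]
    exact this.comp_measurable (by fun_prop)
  have hpt : ∀ p : E × E, rexp (l * (F p.2 - F p.1)) ≤
      ∑ k ∈ Finset.range n, (1 / n : ℝ) * Ψ (ContinuousLinearMap.rotation (k * h) p) := by
    intro p
    set u : ℕ → ℝ := fun k ↦ F (cos (k * h) • p.1 + sin (k * h) • p.2) with hu
    have hu0 : u 0 = F p.1 := by simp [hu]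
    have hun : u n = F p.2 := by
      have : (n : ℝ) * h = π / 2 := by rw [hh]; field_simp
      simp [hu, this]
    have hΨu : ∀ k : ℕ, Ψ (ContinuousLinearMap.rotation (k * h) p) =
        rexp (l * n * (u (k + 1) - u k)) := by
      intro k
      simp only [hΨ, hu, ContinuousLinearMap.rotation_apply]
      congr 4
      have h1 : ((k + 1 : ℕ) : ℝ) * h = k * h + h := by push_cast; ring
      rw [h1, cos_add, sin_add]
      module
    have htel : l * (F p.2 - F p.1) =
        ∑ k ∈ Finset.range n, (1 / n : ℝ) • (l * n * (u (k + 1) - u k)) := by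
      rw [← Finset.smul_sum, ← Finset.mul_sum, Finset.sum_range_sub, hu0, hun, smul_eq_mul]
      field_simp
    rw [htel]
    simp_rw [hΨu, ← smul_eq_mul (1 / n : ℝ) (rexp _)]
    exact convexOn_exp.map_sum_le (fun _ _ ↦ by positivity) (by simp [hn']) (fun _ _ ↦ trivial)
  calc _ ≤ ∫ p, ∑ k ∈ Finset.range n, (1 / n : ℝ) * Ψ (ContinuousLinearMap.rotation (k * h) p)
        ∂((stdGaussian E).prod (stdGaussian E)) :=
        integral_mono_of_nonneg (ae_of_all _ fun p ↦ (exp_pos _).le)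
          (integrable_finsetSum _ fun k _ ↦ (hΨroti _).const_mul _) (ae_of_all _ hpt)
    _ = ∫ p, Ψ p ∂((stdGaussian E).prod (stdGaussian E)) := by
        rw [integral_finsetSum _ fun k _ ↦ (hΨroti _).const_mul _]
        simp_rw [integral_const_mul, hΨrot]
        simp [hn']

/-- Dominated convergence: the rescaled first increment tends to `π / 2` times a directional
derivative, which exists almost everywhere by Rademacher's theorem. -/
theorem LipschitzWith.tendsto_integral_exp_rotation_increment {F : E → ℝ} {K : ℝ≥0}
    (hF : LipschitzWith K F) (l : ℝ) :
    Tendsto (fun n : ℕ ↦ ∫ p : E × E, rexp (l * n * (F (cos (π / (2 * n)) • p.1 +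
        sin (π / (2 * n)) • p.2) - F p.1)) ∂((stdGaussian E).prod (stdGaussian E))) atTop
      (𝓝 (∫ p : E × E, rexp (l * (π / 2) * fderiv ℝ F p.1 p.2)
        ∂((stdGaussian E).prod (stdGaussian E)))) := by
  have hc := hF.continuous
  refine tendsto_integral_of_dominated_convergence
    (fun p ↦ rexp (|l| * (K * (π / 2)) * (‖p.1‖ + ‖p.2‖)))
    (fun n ↦ (by fun_prop : Continuous _).aestronglyMeasurable)
    (integrable_exp_mul_norm_add_norm_prod_stdGaussian _) ?_ ?_
  · intro n
    refine ae_of_all _ fun p ↦ ?_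
    rw [Real.norm_eq_abs, abs_of_pos (exp_pos _)]
    apply Real.exp_le_exp.2
    -- The domination is required for every `n`; at `n = 0` the exponent is `0`.
    rcases Nat.eq_zero_or_pos n with rfl | hn
    · simp; positivity
    have hn' : (0 : ℝ) < n := by exact_mod_cast hn
    refine (le_abs_self _).trans ?_
    rw [abs_mul, abs_mul, Nat.abs_cast]
    calc |l| * n * |F (cos (π / (2 * n)) • p.1 + sin (π / (2 * n)) • p.2) - F p.1|
        ≤ |l| * n * (K * (π / (2 * n) * (‖p.1‖ + ‖p.2‖))) := by
          gcongr
          exact abs_sub_le_of_lipschitz_rotation hF (by positivity) p.1 p.2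
      _ = _ := by field_simp
  · have hdiff : ∀ᵐ x ∂(stdGaussian E), DifferentiableAt ℝ F x :=
      stdGaussian_absolutelyContinuous.ae_le hF.ae_differentiableAt
    have hdiff' : ∀ᵐ p ∂((stdGaussian E).prod (stdGaussian E)), DifferentiableAt ℝ F p.1 :=
      Measure.quasiMeasurePreserving_fst.ae hdiff
    filter_upwards [hdiff'] with p hp
    apply (continuous_exp.tendsto _).comp
    have hcurve : HasDerivAt (fun s : ℝ ↦ cos s • p.1 + sin s • p.2) p.2 0 := by
      have := ((hasDerivAt_cos 0).smul_const p.1).add ((hasDerivAt_sin 0).smul_const p.2)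
      simp only [sin_zero, cos_zero, neg_zero, zero_smul, one_smul, zero_add] at this
      exact this
    have hG : HasDerivAt (fun s : ℝ ↦ F (cos s • p.1 + sin s • p.2)) (fderiv ℝ F p.1 p.2) 0 := by
      have h1 : HasFDerivAt F (fderiv ℝ F p.1) (cos 0 • p.1 + sin 0 • p.2) := by
        simpa using hp.hasFDerivAt
      exact h1.comp_hasDerivAt 0 hcurve
    have hs := hG.tendsto_slope_zero
    have hseq : Tendsto (fun n : ℕ ↦ π / (2 * n)) atTop (𝓝[≠] 0) := by
      refine tendsto_nhdsWithin_iff.2 ⟨?_, ?_⟩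
      · exact tendsto_const_nhds.div_atTop
          (tendsto_natCast_atTop_atTop.const_mul_atTop (by norm_num))
      · filter_upwards [eventually_gt_atTop 0] with n hn
        have : (0 : ℝ) < n := by exact_mod_cast hn
        exact (by positivity : π / (2 * (n : ℝ)) ≠ 0)
    have hlim := (hs.comp hseq).const_mul (l * (π / 2))
    refine hlim.congr' ?_
    filter_upwards [eventually_gt_atTop 0] with n hn
    have : (0 : ℝ) < n := by exact_mod_cast hn
    simp only [Function.comp, zero_add, cos_zero, sin_zero, one_smul, zero_smul, add_zero,
      smul_eq_mul]
    field_simp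

/-- Dimension-free Gaussian concentration in Laplace transform form, for the difference of two
independent copies of a Lipschitz function of a standard Gaussian vector. -/
theorem LipschitzWith.integral_exp_mul_sub_stdGaussian_le {F : E → ℝ} {K : ℝ≥0}
    (hF : LipschitzWith K F) (l : ℝ) :
    ∫ p : E × E, rexp (l * (F p.2 - F p.1)) ∂((stdGaussian E).prod (stdGaussian E)) ≤
      rexp ((l * (π / 2)) ^ 2 * K ^ 2 / 2) := by
  have h1 : ∫ p : E × E, rexp (l * (F p.2 - F p.1)) ∂((stdGaussian E).prod (stdGaussian E)) ≤
      ∫ p : E × E, rexp (l * (π / 2) * fderiv ℝ F p.1 p.2)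
        ∂((stdGaussian E).prod (stdGaussian E)) := by
    refine ge_of_tendsto (hF.tendsto_integral_exp_rotation_increment l) ?_
    filter_upwards [eventually_ne_atTop 0] with n hn
    exact hF.integral_exp_sub_le_rotation_increment l hn
  refine h1.trans ?_
  have hmeas : Measurable fun p : E × E ↦ fderiv ℝ F p.1 p.2 :=
    have : ProperSpace (E →L[ℝ] ℝ) := FiniteDimensional.proper ℝ _
    (isBoundedBilinearMap_apply (𝕜 := ℝ) (E := E) (F := ℝ)).continuous.measurable.comp
      (((measurable_fderiv ℝ F).comp measurable_fst).prodMk measurable_snd)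
  have hbound : ∀ x, ‖fderiv ℝ F x‖ ≤ K := fun x ↦ norm_fderiv_le_of_lipschitz ℝ hF
  have hint : Integrable (fun p : E × E ↦ rexp (l * (π / 2) * fderiv ℝ F p.1 p.2))
      ((stdGaussian E).prod (stdGaussian E)) := by
    refine (integrable_exp_mul_norm_add_norm_prod_stdGaussian (|l * (π / 2)| * K)).mono'
      (by fun_prop) (ae_of_all _ fun p ↦ ?_)
    rw [Real.norm_eq_abs, abs_of_pos (exp_pos _)]
    apply Real.exp_le_exp.2
    refine (le_abs_self _).trans ?_
    rw [abs_mul, mul_assoc]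
    gcongr
    rw [← Real.norm_eq_abs]
    calc ‖fderiv ℝ F p.1 p.2‖ ≤ K * ‖p.2‖ := (fderiv ℝ F p.1).le_of_opNorm_le (hbound _) _
      _ ≤ K * (‖p.1‖ + ‖p.2‖) := by gcongr; simp
  -- For fixed `x` the exponent is linear in `y`, so the inner integral is an explicit Gaussian
  -- Laplace transform.
  rw [integral_prod _ hint]
  simp_rw [integral_exp_mul_strongDual_stdGaussian]
  calc ∫ x, rexp ((l * (π / 2)) ^ 2 * ‖fderiv ℝ F x‖ ^ 2 / 2) ∂(stdGaussian E)
      ≤ ∫ x, rexp ((l * (π / 2)) ^ 2 * K ^ 2 / 2) ∂(stdGaussian E) := by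
        refine integral_mono_of_nonneg (ae_of_all _ fun p ↦ (exp_pos _).le)
          (integrable_const _) (ae_of_all _ fun x ↦ ?_)
        apply Real.exp_le_exp.2
        gcongr
        exact hbound x
    _ = _ := by simp

end GaussianConcentration

/-! ### From Gaussian vectors to the unit sphere -/

section SphereConcentration

open ProbabilityTheory Real Metric

section Direction

variable {E : Type*} [NormedAddCommGroup E] [NormedSpace ℝ E]

open Classical in
/-- The degree zero homogeneous extension of a function on the unit sphere, with value `0` at the
origin. -/
noncomputable def directionExt (b : sphere (0 : E) 1 → ℝ) (x : E) : ℝ :=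
  if h : x ∈ ({0}ᶜ : Set E) then b (homeomorphUnitSphereProd E ⟨x, h⟩).1 else 0

theorem directionExt_zero (b : sphere (0 : E) 1 → ℝ) : directionExt b 0 = 0 := by
  simp [directionExt]

theorem directionExt_coe (b : sphere (0 : E) 1 → ℝ) (x : ({0}ᶜ : Set E)) :
    directionExt b x = b (homeomorphUnitSphereProd E x).1 := by
  rw [directionExt, dif_pos x.2]

theorem directionExt_of_ne_zero (b : sphere (0 : E) 1 → ℝ) {x : E} (hx : x ≠ 0) :
    directionExt b x = b (homeomorphUnitSphereProd E ⟨x, hx⟩).1 :=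
  directionExt_coe b ⟨x, hx⟩

theorem measurable_directionExt [MeasurableSpace E] [BorelSpace E] {b : sphere (0 : E) 1 → ℝ}
    (hb : Measurable b) : Measurable (directionExt b) := by
  classical
  exact Measurable.dite (hb.comp (measurable_fst.comp (homeomorphUnitSphereProd E).measurable))
    measurable_const (measurableSet_singleton _).compl

theorem abs_directionExt_le {b : sphere (0 : E) 1 → ℝ} {C : ℝ} (hC : 0 ≤ C)
    (hb : ∀ u, |b u| ≤ C) (x : E) : |directionExt b x| ≤ C := by
  rw [directionExt]
  split_ifs with h
  · exact hb _
  · simpa using hC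

/-- The degree one homogeneous extension of a bounded Lipschitz function on the unit sphere is
Lipschitz. -/
theorem LipschitzWith.norm_mul_directionExt {g : sphere (0 : E) 1 → ℝ} {K : ℝ≥0}
    (hg : LipschitzWith K g) (hb : ∀ u, |g u| ≤ 2 * K) :
    LipschitzWith (4 * K) fun x : E ↦ ‖x‖ * directionExt g x := by
  apply LipschitzWith.of_dist_le_mul
  -- The constant `4` is `2 + 2`: the change of the norm costs `2 * K` because `|g| ≤ 2 * K`, and
  -- the change of direction costs `2 * K` because `‖y‖ * ‖u - v‖ ≤ 2 * ‖x - y‖`.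
  have key : ∀ x y : E, ‖y‖ ≤ ‖x‖ → y ≠ 0 →
      |‖x‖ * directionExt g x - ‖y‖ * directionExt g y| ≤ 4 * K * ‖x - y‖ := by
    intro x y hxy hy
    have hx : x ≠ 0 := fun h ↦ hy (by simpa [h] using hxy)
    have hx' : 0 < ‖x‖ := norm_pos_iff.2 hx
    have hy' : 0 < ‖y‖ := norm_pos_iff.2 hy
    rw [directionExt_of_ne_zero g hx, directionExt_of_ne_zero g hy]
    set u := (homeomorphUnitSphereProd E ⟨x, hx⟩).1 with hu
    set v := (homeomorphUnitSphereProd E ⟨y, hy⟩).1 with hv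
    have hu' : (u : E) = ‖x‖⁻¹ • x := by simp [hu]
    have hv' : (v : E) = ‖y‖⁻¹ • y := by simp [hv]
    have h1 : |‖x‖ - ‖y‖| ≤ ‖x - y‖ := abs_norm_sub_norm_le x y
    have h2 : |g u - g v| ≤ K * ‖(u : E) - v‖ := by
      simpa [Real.dist_eq, Subtype.dist_eq, dist_eq_norm] using hg.dist_le_mul u v
    have h3 : ‖y‖ * ‖(u : E) - v‖ ≤ 2 * ‖x - y‖ := by
      calc ‖y‖ * ‖(u : E) - v‖ = ‖‖y‖ • ((u : E) - v)‖ := by rw [norm_smul, norm_norm]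
        _ = ‖((‖y‖ - ‖x‖) * ‖x‖⁻¹) • x + (x - y)‖ := by
            rw [hu', hv', smul_sub, smul_smul, smul_smul, mul_inv_cancel₀ hy'.ne', sub_mul,
              mul_inv_cancel₀ hx'.ne']
            congr 1
            module
        _ ≤ ‖((‖y‖ - ‖x‖) * ‖x‖⁻¹) • x‖ + ‖x - y‖ := norm_add_le _ _
        _ = |‖x‖ - ‖y‖| + ‖x - y‖ := by
            rw [norm_smul, norm_mul, norm_inv, norm_norm, mul_assoc, inv_mul_cancel₀ hx'.ne',
              mul_one, Real.norm_eq_abs, abs_sub_comm]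
        _ ≤ _ := by linarith
    calc |‖x‖ * g u - ‖y‖ * g v| = |(‖x‖ - ‖y‖) * g u + ‖y‖ * (g u - g v)| := by ring_nf
      _ ≤ |‖x‖ - ‖y‖| * |g u| + ‖y‖ * |g u - g v| := by
          refine (abs_add_le _ _).trans ?_
          rw [abs_mul, abs_mul, abs_norm]
      _ ≤ ‖x - y‖ * (2 * K) + ‖y‖ * (K * ‖(u : E) - v‖) := by
          gcongr
          exact hb u
      _ = ‖x - y‖ * (2 * K) + K * (‖y‖ * ‖(u : E) - v‖) := by ring
      _ ≤ ‖x - y‖ * (2 * K) + K * (2 * ‖x - y‖) := by gcongr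
      _ = _ := by ring
  have key0 : ∀ x : E, |‖x‖ * directionExt g x| ≤ 4 * K * ‖x‖ := by
    intro x
    rw [abs_mul, abs_norm]
    have := abs_directionExt_le (by positivity) hb x
    nlinarith [norm_nonneg x, mul_le_mul_of_nonneg_left this (norm_nonneg x), K.2]
  intro x y
  rw [Real.dist_eq, dist_eq_norm]
  push_cast
  rcases eq_or_ne x 0 with rfl | hx
  · simpa using key0 y
  rcases eq_or_ne y 0 with rfl | hy
  · simpa using key0 x
  rcases le_total ‖y‖ ‖x‖ with h | h
  · exact key x y h hy
  · rw [abs_sub_comm, norm_sub_rev]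
    exact key y x h hx

/-- Polar coordinates turn `μ` into a product measure, so the integral factors; the case `b = 1`
identifies the radial factor. -/
theorem integral_norm_mul_directionExt [FiniteDimensional ℝ E] [MeasurableSpace E] [BorelSpace E]
    (μ : Measure E) [μ.IsAddHaarMeasure] [Nontrivial E] (a : ℝ → ℝ) (b : sphere (0 : E) 1 → ℝ) :
    ∫ x, a ‖x‖ * directionExt b x ∂μ = (⨍ u, b u ∂μ.toSphere) * ∫ x, a ‖x‖ ∂μ := by
  have key : ∀ b : sphere (0 : E) 1 → ℝ, ∫ x, a ‖x‖ * directionExt b x ∂μ =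
      (∫ u, b u ∂μ.toSphere) *
        ∫ r : Set.Ioi (0 : ℝ), a r ∂(Measure.volumeIoiPow (Module.finrank ℝ E - 1)) := by
    intro b
    calc ∫ x, a ‖x‖ * directionExt b x ∂μ
        = ∫ x : ({(0)}ᶜ : Set E), a ‖x.1‖ * directionExt b x.1 ∂(μ.comap (↑)) := by
          rw [integral_subtype_comap (measurableSet_singleton _).compl
            fun x ↦ a ‖x‖ * directionExt b x, restrict_compl_singleton]
      _ = ∫ p, b p.1 * a p.2 ∂μ.toSphere.prod (.volumeIoiPow (Module.finrank ℝ E - 1)) := by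
          simp_rw [directionExt_coe]
          rw [← μ.measurePreserving_homeomorphUnitSphereProd.integral_comp
            (Homeomorph.measurableEmbedding _) fun p ↦ b p.1 * a p.2]
          simp [mul_comm]
      _ = _ := integral_prod_mul b fun r : Set.Ioi (0 : ℝ) ↦ a r
  have hone : ∫ x, a ‖x‖ ∂μ = ∫ x, a ‖x‖ * directionExt (fun _ ↦ 1) x ∂μ := by
    apply integral_congr_ae
    have : ∀ᵐ x ∂μ, x ≠ 0 := by simp [ae_iff]
    filter_upwards [this] with x hx
    rw [directionExt_of_ne_zero _ hx, mul_one]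
  have hne : μ.toSphere.real Set.univ ≠ 0 := by
    rw [Measure.real, ENNReal.toReal_ne_zero]
    exact ⟨Measure.measure_univ_ne_zero.2 μ.toSphere_ne_zero, measure_ne_top _ _⟩
  rw [hone, key b, key, average_eq]
  simp only [integral_const, smul_eq_mul, mul_one]
  field_simp

end Direction

section Gaussian

variable {E : Type*} [NormedAddCommGroup E] [InnerProductSpace ℝ E] [FiniteDimensional ℝ E]
  [MeasurableSpace E] [BorelSpace E]

/-- Independence of norm and direction: the Gaussian density is radial and is absorbed into `a`. -/
theorem integral_norm_mul_directionExt_stdGaussian [Nontrivial E] (a : ℝ → ℝ)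
    (b : sphere (0 : E) 1 → ℝ) :
    ∫ x, a ‖x‖ * directionExt b x ∂(stdGaussian E) =
      (⨍ u, b u ∂(volume : Measure E).toSphere) * ∫ x, a ‖x‖ ∂(stdGaussian E) := by
  obtain ⟨c, hc, h⟩ := exists_stdGaussian_eq_withDensity (E := E)
  have key : ∀ f : E → ℝ, ∫ x, f x ∂(stdGaussian E) =
      ∫ x, c * rexp (-(1 / 2) * ‖x‖ ^ 2) * f x := by
    intro f
    rw [h, integral_withDensity_eq_integral_toReal_smul (by fun_prop) (by simp)]
    refine integral_congr_ae (ae_of_all _ fun x ↦ ?_)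
    simp only [smul_eq_mul]
    rw [ENNReal.toReal_ofReal (by positivity)]
  rw [key, key]
  have := integral_norm_mul_directionExt (volume : Measure E)
    (fun r ↦ c * rexp (-(1 / 2) * r ^ 2) * a r) b
  simpa only [mul_assoc] using this

theorem integrable_norm_stdGaussian : Integrable (fun x : E ↦ ‖x‖) (stdGaussian E) :=
  (IsGaussian.integrable_id (μ := stdGaussian E)).norm

theorem LipschitzWith.integrable_exp_mul_stdGaussian {F : E → ℝ} {K : ℝ≥0}
    (hF : LipschitzWith K F) (l : ℝ) :
    Integrable (fun x ↦ rexp (l * F x)) (stdGaussian E) := by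
  have hc := hF.continuous
  refine ((integrable_exp_mul_norm_stdGaussian (|l| * K)).const_mul (rexp (|l| * |F 0|))).mono'
    (by fun_prop) (ae_of_all _ fun x ↦ ?_)
  rw [Real.norm_eq_abs, abs_of_pos (exp_pos _), ← Real.exp_add]
  apply Real.exp_le_exp.2
  refine (le_abs_self _).trans ?_
  rw [abs_mul, mul_assoc, ← mul_add]
  gcongr
  have : |F x - F 0| ≤ K * ‖x‖ := by
    simpa [Real.dist_eq] using hF.dist_le_mul x 0
  calc |F x| = |F 0 + (F x - F 0)| := by ring_nf
    _ ≤ |F 0| + |F x - F 0| := abs_add_le _ _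
    _ ≤ _ := by gcongr

theorem LipschitzWith.integrable_stdGaussian {F : E → ℝ} {K : ℝ≥0}
    (hF : LipschitzWith K F) : Integrable F (stdGaussian E) := by
  have hc := hF.continuous
  refine ((integrable_norm_stdGaussian.const_mul (K : ℝ)).add
    (integrable_const (|F 0|))).mono' (by fun_prop) (ae_of_all _ fun x ↦ ?_)
  have : |F x - F 0| ≤ K * ‖x‖ := by
    simpa [Real.dist_eq] using hF.dist_le_mul x 0
  calc |F x| = |(F x - F 0) + F 0| := by ring_nf
    _ ≤ |F x - F 0| + |F 0| := abs_add_le _ _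
    _ ≤ _ := by simpa using this

/-- Gaussian concentration in Laplace transform form for a centred Lipschitz function. -/
theorem LipschitzWith.integral_exp_mul_stdGaussian_le {F : E → ℝ} {K : ℝ≥0}
    (hF : LipschitzWith K F) (h0 : ∫ x, F x ∂(stdGaussian E) = 0) (l : ℝ) :
    ∫ x, rexp (l * F x) ∂(stdGaussian E) ≤ rexp ((l * (π / 2)) ^ 2 * K ^ 2 / 2) := by
  -- Jensen for the centred `F`. The two-copy integral factors, and this factor of it can then be
  -- dropped.
  have h1 : (1 : ℝ) ≤ ∫ x, rexp (-l * F x) ∂(stdGaussian E) := by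
    have h2 : ∫ x, (-l * F x + 1) ∂(stdGaussian E) ≤ ∫ x, rexp (-l * F x) ∂(stdGaussian E) :=
      integral_mono ((hF.integrable_stdGaussian.const_mul _).add (integrable_const _))
        (hF.integrable_exp_mul_stdGaussian _) fun x ↦ Real.add_one_le_exp _
    rwa [integral_add (hF.integrable_stdGaussian.const_mul _) (integrable_const _),
      integral_const_mul, h0, mul_zero, zero_add, integral_const, probReal_univ, one_smul] at h2
  have h3 := hF.integral_exp_mul_sub_stdGaussian_le l
  have h4 : ∫ p : E × E, rexp (l * (F p.2 - F p.1)) ∂((stdGaussian E).prod (stdGaussian E)) =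
      (∫ x, rexp (-l * F x) ∂(stdGaussian E)) * ∫ x, rexp (l * F x) ∂(stdGaussian E) := by
    rw [← integral_prod_mul]
    refine integral_congr_ae (ae_of_all _ fun p ↦ ?_)
    simp only
    rw [← Real.exp_add]
    ring_nf
  rw [h4] at h3
  refine le_trans ?_ h3
  exact le_mul_of_one_le_left (integral_nonneg fun x ↦ (exp_pos _).le) h1

/-- A centred Lipschitz function on the unit sphere is subgaussian. -/
theorem LipschitzWith.average_exp_sphere_le [Nontrivial E] {g : sphere (0 : E) 1 → ℝ} {K : ℝ≥0}
    (hg : LipschitzWith K g) (h0 : ⨍ u, g u ∂(volume : Measure E).toSphere = 0) (l : ℝ) :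
    ⨍ u, rexp (l * (∫ x, ‖x‖ ∂(stdGaussian E)) * g u) ∂(volume : Measure E).toSphere ≤
      rexp (2 * π ^ 2 * l ^ 2 * K ^ 2) := by
  have : NeZero (volume : Measure E).toSphere := ⟨Measure.toSphere_ne_zero _⟩
  set c : ℝ := ∫ x, ‖x‖ ∂(stdGaussian E) with hc
  have hgi : Integrable g (volume : Measure E).toSphere :=
    hg.continuous.integrable_of_hasCompactSupport (HasCompactSupport.of_compactSpace g)
  -- As `g` has mean zero, `g u` is the average of `g u - g v`, and the sphere has diameter `2`.
  have hb : ∀ u, |g u| ≤ 2 * K := by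
    intro u
    have h1 : g u = ⨍ v, (g u - g v) ∂(volume : Measure E).toSphere := by
      have hp : IsProbabilityMeasure (((volume : Measure E).toSphere Set.univ)⁻¹ •
        (volume : Measure E).toSphere) := inferInstance
      have hgi' := hgi.to_average
      rw [average, integral_sub (integrable_const _) hgi']
      rw [average] at h0
      rw [h0, integral_const, probReal_univ, one_smul, sub_zero]
    rw [h1, ← Real.norm_eq_abs]
    have h2 : ∀ v, ‖g u - g v‖ ≤ 2 * K := by
      intro v
      calc ‖g u - g v‖ ≤ K * dist u v := by
            exact hg.dist_le_mul u v
        _ ≤ K * 2 := by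
            gcongr
            rw [Subtype.dist_eq, dist_eq_norm]
            refine (_root_.norm_sub_le (u : E) (v : E)).trans ?_
            rw [norm_eq_of_mem_sphere, norm_eq_of_mem_sphere]
            norm_num
        _ = _ := mul_comm _ _
    have hp : IsProbabilityMeasure (((volume : Measure E).toSphere Set.univ)⁻¹ •
      (volume : Measure E).toSphere) := inferInstance
    rw [average]
    refine (norm_integral_le_of_norm_le_const (ae_of_all _ h2)).trans ?_
    rw [probReal_univ, mul_one]
  set G : E → ℝ := fun x ↦ ‖x‖ * directionExt g x with hG
  have hGlip : LipschitzWith (4 * K) G := hg.norm_mul_directionExt hb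
  have hG0 : ∫ x, G x ∂(stdGaussian E) = 0 := by
    have := integral_norm_mul_directionExt_stdGaussian (fun r ↦ r) g
    rw [h0, zero_mul] at this
    exact this
  have hmain := hGlip.integral_exp_mul_stdGaussian_le hG0 l
  set b₁ : sphere (0 : E) 1 → ℝ := fun u ↦ rexp (l * c * g u) with hb₁
  set b₂ : sphere (0 : E) 1 → ℝ := fun u ↦ l * g u * rexp (l * c * g u) with hb₂
  have hgc := hg.continuous
  have hb₁c : Continuous b₁ := by fun_prop
  have hb₂c : Continuous b₂ := by fun_prop
  have hbdd : ∀ b : sphere (0 : E) 1 → ℝ, Continuous b → ∃ C, 0 ≤ C ∧ ∀ u, |b u| ≤ C := by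
    intro b hb
    obtain ⟨C, hC⟩ := isCompact_univ.exists_bound_of_continuousOn hb.continuousOn
    exact ⟨max C 0, le_max_right _ _, fun u ↦ (hC u trivial).trans (le_max_left _ _)⟩
  have hint₁ : Integrable (fun x ↦ (1 : ℝ) * directionExt b₁ x) (stdGaussian E) := by
    obtain ⟨C, hC, hbC⟩ := hbdd b₁ hb₁c
    refine (integrable_const C).mono'
      ((measurable_directionExt hb₁c.measurable).const_mul _).aestronglyMeasurable
      (ae_of_all _ fun x ↦ ?_)
    rw [one_mul]
    exact abs_directionExt_le hC hbC x
  have hint₂ : Integrable (fun x ↦ (‖x‖ - c) * directionExt b₂ x) (stdGaussian E) := by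
    obtain ⟨C, hC, hbC⟩ := hbdd b₂ hb₂c
    exact (integrable_norm_stdGaussian.sub (integrable_const c)).mul_bdd
      (measurable_directionExt hb₂c.measurable).aestronglyMeasurable
      (ae_of_all _ fun x ↦ abs_directionExt_le hC hbC x)
  -- Tangent line of `exp` at `‖x‖ = c`. On integration the second term vanishes, since `c` is the
  -- mean of the norm. At the origin the left side is `0`.
  have hlow : ∀ x, (1 : ℝ) * directionExt b₁ x + (‖x‖ - c) * directionExt b₂ x ≤
      rexp (l * G x) := by
    intro x
    rcases eq_or_ne x 0 with rfl | hx
    · simp [directionExt_zero, hG]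
    · simp only [hG, directionExt_of_ne_zero _ hx, hb₁, hb₂]
      set y := g (homeomorphUnitSphereProd E ⟨x, hx⟩).1
      have h1 := Real.add_one_le_exp (l * (‖x‖ - c) * y)
      have h2 : rexp (l * (‖x‖ * y)) = rexp (l * c * y) * rexp (l * (‖x‖ - c) * y) := by
        rw [← Real.exp_add]
        ring_nf
      rw [h2]
      nlinarith [exp_pos (l * c * y)]
  have hle := integral_mono (hint₁.add hint₂) (hGlip.integrable_exp_mul_stdGaussian l) hlow
  have hadd := integral_add hint₁ hint₂
  simp only [Pi.add_apply] at hle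
  rw [hadd, integral_norm_mul_directionExt_stdGaussian (fun _ ↦ 1) b₁,
    integral_norm_mul_directionExt_stdGaussian (fun r ↦ r - c) b₂,
    integral_sub integrable_norm_stdGaussian (integrable_const c)] at hle
  simp only [integral_const, probReal_univ, one_smul, ← hc, sub_self, mul_zero, add_zero,
    mul_one] at hle
  refine hle.trans (hmain.trans_eq ?_)
  congr 1
  push_cast
  ring

/-- Lévy's concentration inequality on the unit sphere, upper tail of a centred function. -/
theorem LipschitzWith.sphere_upper_tail_le [Nontrivial E] {g : sphere (0 : E) 1 → ℝ} {K : ℝ≥0}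
    (hK : 0 < K) (hg : LipschitzWith K g)
    (h0 : ⨍ u, g u ∂(volume : Measure E).toSphere = 0) {s : ℝ} (hs : 0 < s) :
    (((volume : Measure E).toSphere Set.univ)⁻¹ • (volume : Measure E).toSphere).real
      {u | s ≤ g u} ≤
      rexp (-((∫ x, ‖x‖ ∂(stdGaussian E)) ^ 2 * s ^ 2 / (8 * π ^ 2 * K ^ 2))) := by
  have : NeZero (volume : Measure E).toSphere := ⟨Measure.toSphere_ne_zero _⟩
  set c : ℝ := ∫ x, ‖x‖ ∂(stdGaussian E) with hc
  have hc0 : 0 ≤ c := integral_nonneg fun x ↦ norm_nonneg x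
  -- The minimizer of the Chernoff exponent `-l * c * s + 2 * π ^ 2 * l ^ 2 * K ^ 2`.
  set l : ℝ := c * s / (4 * π ^ 2 * K ^ 2) with hl
  have hK' : (0 : ℝ) < K := hK
  have hgc := hg.continuous
  have hint : Integrable (fun u ↦ rexp (l * c * g u)) (volume : Measure E).toSphere :=
    Continuous.integrable_of_hasCompactSupport (by fun_prop) (HasCompactSupport.of_compactSpace _)
  refine (measure_ge_le_exp_mul_mgf s (t := l * c) (by positivity) hint.to_average).trans ?_
  have h1 := hg.average_exp_sphere_le h0 l
  rw [← hc, average] at h1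
  calc _ ≤ rexp (-(l * c) * s) * rexp (2 * π ^ 2 * l ^ 2 * K ^ 2) := by
        gcongr
        exact h1
    _ = _ := by
        rw [← Real.exp_add]
        congr 1
        rw [hl]
        field_simp
        ring

end Gaussian

/-- The first absolute moment of a standard Gaussian real random variable. -/
noncomputable def gaussianAbsMoment : ℝ := ∫ x, |x| ∂(gaussianReal 0 1)

theorem gaussianAbsMoment_pos : 0 < gaussianAbsMoment := by
  have hi : Integrable (fun x : ℝ ↦ |x|) (gaussianReal 0 1) :=
    (IsGaussian.integrable_id (μ := gaussianReal 0 1)).norm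
  rw [gaussianAbsMoment, integral_pos_iff_support_of_nonneg (fun x ↦ abs_nonneg x) hi]
  have hs : Function.support (fun x : ℝ ↦ |x|) = {0}ᶜ := by
    ext x
    simp
  have : NullSingletonClass (gaussianReal 0 1) :=
    nullSingletonClass_gaussianReal (by norm_num)
  rw [hs, prob_compl_eq_one_sub (measurableSet_singleton _), measure_singleton]
  simp

/-- Integrate `∑ i, |x i| ≤ √M * ‖x‖`, where every coordinate is a standard Gaussian variable. This
is the source of the factor `M` in the concentration exponent. -/
theorem gaussianAbsMoment_mul_sqrt_le (M : ℕ) :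
    gaussianAbsMoment * √M ≤ ∫ x, ‖x‖ ∂(stdGaussian (EuclideanSpace ℝ (Fin M))) := by
  rcases Nat.eq_zero_or_pos M with rfl | hM
  · simpa using integral_nonneg fun x ↦ norm_nonneg x
  have hM' : (0 : ℝ) < M := by exact_mod_cast hM
  have hmp : ∀ i : Fin M, MeasurePreserving (fun x : EuclideanSpace ℝ (Fin M) ↦ x i)
      (stdGaussian (EuclideanSpace ℝ (Fin M))) (gaussianReal 0 1) := by
    intro i
    have := measurePreserving_eval_multivariateGaussian (μ := (0 : EuclideanSpace ℝ (Fin M)))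
      Matrix.PosSemidef.one (i := i)
    simpa using this
  have hi : Integrable (fun x : ℝ ↦ |x|) (gaussianReal 0 1) :=
    (IsGaussian.integrable_id (μ := gaussianReal 0 1)).norm
  have hcoord : ∀ i : Fin M, ∫ x : EuclideanSpace ℝ (Fin M), |x i|
      ∂(stdGaussian (EuclideanSpace ℝ (Fin M))) = gaussianAbsMoment := by
    intro i
    rw [gaussianAbsMoment, ← (hmp i).map_eq, integral_map (hmp i).measurable.aemeasurable
      (by fun_prop)]
  have hcoordi : ∀ i : Fin M, Integrable (fun x : EuclideanSpace ℝ (Fin M) ↦ |x i|)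
      (stdGaussian (EuclideanSpace ℝ (Fin M))) := fun i ↦ (hmp i).integrable_comp_of_integrable hi
  have hpt : ∀ x : EuclideanSpace ℝ (Fin M), ∑ i, |x i| ≤ √M * ‖x‖ := by
    intro x
    rw [EuclideanSpace.norm_eq, ← Real.sqrt_mul hM'.le]
    apply Real.le_sqrt_of_sq_le
    have := sq_sum_le_card_mul_sum_sq (s := Finset.univ) (f := fun i ↦ |x i|)
    simpa using this
  have hle := integral_mono (integrable_finsetSum Finset.univ fun i _ ↦ hcoordi i)
    (integrable_norm_stdGaussian.const_mul (√M)) hpt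
  rw [integral_finsetSum _ fun i _ ↦ hcoordi i, integral_const_mul] at hle
  simp_rw [hcoord] at hle
  simp only [Finset.sum_const, Finset.card_univ, Fintype.card_fin, nsmul_eq_mul] at hle
  have h2 : (M : ℝ) = √M * √M := (Real.mul_self_sqrt hM'.le).symm
  have h3 : 0 < √(M : ℝ) := Real.sqrt_pos.2 hM'
  have h4 : √(M : ℝ) * (gaussianAbsMoment * √M) ≤
      √M * ∫ x, ‖x‖ ∂(stdGaussian (EuclideanSpace ℝ (Fin M))) := by
    calc √(M : ℝ) * (gaussianAbsMoment * √M) = √M * √M * gaussianAbsMoment := by ring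
      _ = M * gaussianAbsMoment := by rw [← h2]
      _ ≤ _ := hle
  exact le_of_mul_le_mul_left h4 h3

end SphereConcentration

/-! ### Lévy concentration on sets of full surface measure -/

section LevyConcentration

open Real

theorem uniformOn_eq_of_measure_compl_eq_zero {M : ℕ} {Θ : Set (ParamSphere M)}
    (h0 : surfaceMeasure M Θᶜ = 0) :
    uniformOn Θ = (surfaceMeasure M Set.univ)⁻¹ • surfaceMeasure M := by
  have hae : Θ =ᵐ[surfaceMeasure M] Set.univ := by
    rw [ae_eq_univ]
    exact h0
  rw [uniformOn, ProbabilityTheory.cond, measure_congr hae, Measure.restrict_congr_set hae, Measure.restrict_univ]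

/-- Lévy concentration on a subset of full measure of the sphere. -/
theorem levyConcentration_of_measure_compl_eq_zero {M : ℕ} (hM : 1 ≤ M)
    {Θ : Set (ParamSphere M)} (h0 : surfaceMeasure M Θᶜ = 0) :
    LevyConcentration (gaussianAbsMoment ^ 2 / (8 * π ^ 2)) Θ := by
  intro f K hK hf s hs
  have : Nonempty (Fin M) := ⟨⟨0, hM⟩⟩
  have : NeZero (surfaceMeasure M) := ⟨Measure.toSphere_ne_zero _⟩
  have : IsFiniteMeasure (surfaceMeasure M) :=
    inferInstanceAs (IsFiniteMeasure (Measure.toSphere _))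
  rw [uniformOn_eq_of_measure_compl_eq_zero h0]
  set ν := (surfaceMeasure M Set.univ)⁻¹ • surfaceMeasure M with hν
  have hprob : IsProbabilityMeasure ν := inferInstance
  -- `f` is Lipschitz only on `Θ`. A Lipschitz extension from `Θ` to the whole sphere, with the same
  -- constant, agrees with `f` almost everywhere and so has the same mean and tails.
  obtain ⟨g, hg, hfg⟩ := hf.extend_real
  have hae : f =ᵐ[ν] g := by
    have h1 : ∀ᵐ θ ∂(surfaceMeasure M), θ ∈ Θ := by
      rw [ae_iff]
      exact h0
    have h2 : f =ᵐ[surfaceMeasure M] g := by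
      filter_upwards [h1] with θ hθ using hfg hθ
    exact Measure.ae_smul_measure h2 _
  have hgi : Integrable g ν :=
    hg.continuous.integrable_of_hasCompactSupport (HasCompactSupport.of_compactSpace g)
  rw [integral_congr_ae hae]
  set m := ∫ θ, g θ ∂ν with hm
  have hset : ν.real {θ | s ≤ |f θ - m|} = ν.real {θ | s ≤ |g θ - m|} := by
    apply measureReal_congr
    filter_upwards [hae] with θ hθ
    change (s ≤ |f θ - m|) = (s ≤ |g θ - m|)
    rw [hθ]
  rw [hset]
  have htail : ∀ k : ParamSphere M → ℝ, LipschitzWith K k → ∫ θ, k θ ∂ν = 0 →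
      ν.real {θ | s ≤ k θ} ≤
        rexp (-(gaussianAbsMoment ^ 2 / (8 * π ^ 2) * M * s ^ 2 / (K : ℝ) ^ 2)) := by
    intro k hk hk0
    refine (hk.sphere_upper_tail_le hK hk0 hs).trans ?_
    apply Real.exp_le_exp.2
    apply neg_le_neg
    have h1 := gaussianAbsMoment_mul_sqrt_le M
    have h2 : gaussianAbsMoment ^ 2 * M ≤
        (∫ x, ‖x‖ ∂(ProbabilityTheory.stdGaussian (EuclideanSpace ℝ (Fin M)))) ^ 2 := by
      calc gaussianAbsMoment ^ 2 * M = (gaussianAbsMoment * √M) ^ 2 := by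
            rw [mul_pow, Real.sq_sqrt (Nat.cast_nonneg M)]
        _ ≤ _ := by
            have := gaussianAbsMoment_pos
            gcongr
    have hK' : (0 : ℝ) < K := hK
    calc gaussianAbsMoment ^ 2 / (8 * π ^ 2) * M * s ^ 2 / (K : ℝ) ^ 2
        = (gaussianAbsMoment ^ 2 * M) * s ^ 2 / (8 * π ^ 2 * K ^ 2) := by field_simp
      _ ≤ _ := by gcongr
  have hup := htail (fun θ ↦ g θ - m) (by simpa using hg.sub (LipschitzWith.const m))
    (by rw [integral_sub hgi (integrable_const _)]; simp [hm])
  have hlo := htail (fun θ ↦ m - g θ) (by simpa using (LipschitzWith.const m).sub hg)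
    (by rw [integral_sub (integrable_const _) hgi]; simp [hm])
  have hsub : {θ | s ≤ |g θ - m|} ⊆ {θ | s ≤ g θ - m} ∪ {θ | s ≤ m - g θ} := by
    intro θ hθ
    rcases le_abs.1 (show s ≤ |g θ - m| from hθ) with h | h
    · exact Or.inl h
    · exact Or.inr (by simpa using h)
  calc ν.real {θ | s ≤ |g θ - m|} ≤ ν.real ({θ | s ≤ g θ - m} ∪ {θ | s ≤ m - g θ}) :=
        measureReal_mono hsub
    _ ≤ ν.real {θ | s ≤ g θ - m} + ν.real {θ | s ≤ m - g θ} := measureReal_union_le _ _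
    _ ≤ _ := by linarith

end LevyConcentration

/-! ### Trace norm duality -/

section TraceNorm

open Matrix

variable {n : Type*} [Fintype n]

/-- In the order of `ℂ` a nonnegative number is real, and over `ℂ` a matrix with real quadratic form
is Hermitian. -/
theorem Matrix.posSemidef_of_complex_dotProduct_mulVec_nonneg [DecidableEq n] {A : Matrix n n ℂ}
    (hA : ∀ x : n → ℂ, 0 ≤ star x ⬝ᵥ (A *ᵥ x)) : A.PosSemidef := by
  rw [← Matrix.isPositive_toEuclideanLin_iff, LinearMap.isPositive_iff_complex]
  intro x
  have h := hA x.ofLp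
  have h1 : inner ℂ (Matrix.toEuclideanLin A x) x = star (star x.ofLp ⬝ᵥ (A *ᵥ x.ofLp)) := by
    rw [EuclideanSpace.inner_eq_star_dotProduct, ← Matrix.star_dotProduct_star]
    simp [dotProduct_comm, Matrix.toLpLin_apply]
  rw [h1]
  obtain ⟨hre, him⟩ := Complex.le_def.1 h
  refine ⟨?_, by simpa using hre⟩
  apply Complex.ext <;> simp at him ⊢
  exact him.symm

open scoped MatrixOrder in
theorem Matrix.PosSemidef.trace_mul_nonneg [DecidableEq n] {A B : Matrix n n ℂ} (hA : A.PosSemidef)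
    (hB : B.PosSemidef) : 0 ≤ (A * B).trace := by
  obtain ⟨C, rfl⟩ := CStarAlgebra.nonneg_iff_eq_star_mul_self.1 hA.nonneg
  rw [star_eq_conjTranspose, Matrix.mul_assoc, Matrix.trace_mul_comm]
  exact (hB.mul_mul_conjTranspose_same C).trace_nonneg

/-- Cauchy–Schwarz for the sesquilinear form of `W` with `-1 ≤ W ≤ 1`, in additive form. -/
theorem Matrix.re_dotProduct_mulVec_le_half_add [DecidableEq n] {W : Matrix n n ℂ}
    (h₁ : (1 - W).PosSemidef) (h₂ : (1 + W).PosSemidef) (u v : n → ℂ) :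
    (star u ⬝ᵥ (W *ᵥ v)).re ≤ ((star u ⬝ᵥ u).re + (star v ⬝ᵥ v).re) / 2 := by
  have hW : W.IsHermitian := by
    have := (Matrix.isHermitian_one (n := n) (α := ℂ)).sub h₁.1
    simpa using this
  have hsymm : (star v ⬝ᵥ (W *ᵥ u)).re = (star u ⬝ᵥ (W *ᵥ v)).re := by
    have : star v ⬝ᵥ (W *ᵥ u) = star (star u ⬝ᵥ (W *ᵥ v)) := by
      rw [← Matrix.star_dotProduct_star, star_star, Matrix.star_mulVec, hW.eq,
        ← Matrix.dotProduct_mulVec]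
    rw [this]
    simp
  -- Adding the two positivity conditions, at `u + v` and at `u - v`, leaves only the cross terms of
  -- `W`.
  have e₁ := (Complex.le_def.1 (h₁.dotProduct_mulVec_nonneg (u + v))).1
  have e₂ := (Complex.le_def.1 (h₂.dotProduct_mulVec_nonneg (u - v))).1
  simp only [Matrix.sub_mulVec, Matrix.add_mulVec, Matrix.one_mulVec, star_add, star_sub,
    Matrix.mulVec_add, Matrix.mulVec_sub, add_dotProduct, sub_dotProduct, dotProduct_add,
    dotProduct_sub, Complex.add_re, Complex.sub_re, Complex.zero_re] at e₁ e₂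
  linarith

theorem Matrix.re_dotProduct_mulVec_le_sqrt [DecidableEq n] {W : Matrix n n ℂ}
    (h₁ : (1 - W).PosSemidef) (h₂ : (1 + W).PosSemidef) {u : n → ℂ} (hu : star u ⬝ᵥ u = 1)
    (v : n → ℂ) :
    (star u ⬝ᵥ (W *ᵥ v)).re ≤ √(star v ⬝ᵥ v).re := by
  have hv0 : 0 ≤ (star v ⬝ᵥ v).re := (Complex.le_def.1 (dotProduct_star_self_nonneg v)).1
  rcases hv0.eq_or_lt with h | h
  · have hv : v = 0 := by
      apply dotProduct_star_self_eq_zero.1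
      exact Complex.ext h.symm (Complex.le_def.1 (dotProduct_star_self_nonneg v)).2.symm
    simp [hv]
  · set s : ℝ := √(star v ⬝ᵥ v).re with hs
    have hs0 : 0 < s := Real.sqrt_pos.2 h
    have hss : s * s = (star v ⬝ᵥ v).re := Real.mul_self_sqrt hv0
    -- Scaling the unit vector `u` to the length `s` of `v` makes the arithmetic mean equal to `s ^
    -- 2`.
    have := Matrix.re_dotProduct_mulVec_le_half_add h₁ h₂ ((s : ℂ) • u) v
    rw [star_smul, smul_dotProduct, smul_dotProduct, dotProduct_smul, hu, ← hss] at this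
    simp at this
    nlinarith

/-- The trace in an orthonormal basis. -/
theorem Matrix.IsHermitian.trace_eq_sum_eigenvectorBasis [DecidableEq n] {H : Matrix n n ℂ}
    (hH : H.IsHermitian) (A : Matrix n n ℂ) :
    A.trace = ∑ i, star (hH.eigenvectorBasis i).ofLp ⬝ᵥ (A *ᵥ (hH.eigenvectorBasis i).ofLp) := by
  set U : Matrix n n ℂ := (hH.eigenvectorUnitary : Matrix n n ℂ) with hU
  have h1 : A.trace = (star U * A * U).trace := by
    rw [Matrix.trace_mul_comm, ← Matrix.mul_assoc]
    simp [hU]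
  rw [h1, Matrix.trace]
  refine Finset.sum_congr rfl fun i _ ↦ ?_
  rw [Matrix.diag_apply, Matrix.mul_assoc]
  rfl

theorem Matrix.IsHermitian.eigenvectorBasis_dotProduct_self [DecidableEq n] {H : Matrix n n ℂ}
    (hH : H.IsHermitian) (i : n) :
    star (hH.eigenvectorBasis i).ofLp ⬝ᵥ (hH.eigenvectorBasis i).ofLp = 1 := by
  have h := hH.eigenvectorBasis.orthonormal.1 i
  have h2 := inner_self_eq_norm_sq_to_K (𝕜 := ℂ) (hH.eigenvectorBasis i)
  rw [h, EuclideanSpace.inner_eq_star_dotProduct, dotProduct_comm] at h2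
  simpa using h2

/-- In an orthonormal eigenbasis `v i` of `Yᴴ * Y`, the length of `Y v i` is the `i`-th singular
value and bounds the `i`-th diagonal term. -/
theorem re_trace_mul_le_traceNorm [DecidableEq n] {W : Matrix n n ℂ}
    (h₁ : (1 - W).PosSemidef) (h₂ : (1 + W).PosSemidef) (Y : Matrix n n ℂ) :
    (W * Y).trace.re ≤ traceNorm Y := by
  have hH := Matrix.isHermitian_conjTranspose_mul_self Y
  rw [hH.trace_eq_sum_eigenvectorBasis, Complex.re_sum, traceNorm]
  refine Finset.sum_le_sum fun i _ ↦ ?_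
  set v := (hH.eigenvectorBasis i).ofLp with hv
  rw [← Matrix.mulVec_mulVec]
  refine (Matrix.re_dotProduct_mulVec_le_sqrt h₁ h₂ (hH.eigenvectorBasis_dotProduct_self i)
    _).trans_eq ?_
  congr 1
  rw [hH.eigenvalues_eq, ← Matrix.mulVec_mulVec, Matrix.star_mulVec, ← Matrix.dotProduct_mulVec]
  rfl

theorem abs_re_trace_mul_le_traceNorm [DecidableEq n] {W : Matrix n n ℂ}
    (h₁ : (1 - W).PosSemidef) (h₂ : (1 + W).PosSemidef) (Y : Matrix n n ℂ) :
    |(W * Y).trace.re| ≤ traceNorm Y := by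
  refine abs_le'.2 ⟨re_trace_mul_le_traceNorm h₁ h₂ Y, ?_⟩
  have := re_trace_mul_le_traceNorm (W := -W) (by simpa using h₂)
    (by simpa [← sub_eq_add_neg] using h₁) Y
  simpa using this

/-- If `σ² v = s² v` with `s > 0`, then `(σ + s)(σ - s) v = 0` and `σ + s` is injective, so `σ v = s
v`. If `s = 0`, positivity of the diagonal term is enough. -/
theorem traceNorm_le_re_trace [DecidableEq n] {σ : Matrix n n ℂ} (hσ : σ.PosSemidef) :
    traceNorm σ ≤ σ.trace.re := by
  have hH := Matrix.isHermitian_conjTranspose_mul_self σ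
  rw [hH.trace_eq_sum_eigenvectorBasis σ, Complex.re_sum, traceNorm]
  refine Finset.sum_le_sum fun i _ ↦ ?_
  set v := (hH.eigenvectorBasis i).ofLp with hv
  have hv1 : star v ⬝ᵥ v = 1 := hH.eigenvectorBasis_dotProduct_self i
  have hnn : 0 ≤ (star v ⬝ᵥ (σ *ᵥ v)).re := (Complex.le_def.1 (hσ.dotProduct_mulVec_nonneg v)).1
  set s : ℝ := √(hH.eigenvalues i) with hs
  rcases (Real.sqrt_nonneg (hH.eigenvalues i)).eq_or_lt with h0 | h0
  · rw [hs, ← h0]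
    exact hnn
  have hlam : s * s = hH.eigenvalues i := Real.mul_self_sqrt (Real.sqrt_pos.1 h0).le
  have heig : σ *ᵥ (σ *ᵥ v) = ((s * s : ℝ) : ℂ) • v := by
    have := hH.mulVec_eigenvectorBasis i
    rw [← Matrix.mulVec_mulVec, ← hv, ← hlam] at this
    rw [Complex.coe_smul, ← this, hσ.1.eq]
  set w := σ *ᵥ v - (s : ℂ) • v with hw
  have hw0 : σ *ᵥ w + (s : ℂ) • w = 0 := by
    rw [hw, Matrix.mulVec_sub, heig, Matrix.mulVec_smul, smul_sub, smul_smul]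
    push_cast
    abel
  have hww : star w ⬝ᵥ w = 0 := by
    have h1 : star w ⬝ᵥ (σ *ᵥ w) + (s : ℂ) * (star w ⬝ᵥ w) = 0 := by
      rw [← smul_eq_mul, ← dotProduct_smul, ← dotProduct_add, hw0, dotProduct_zero]
    have h2 := hσ.dotProduct_mulVec_nonneg w
    have h3 : 0 ≤ star w ⬝ᵥ w := dotProduct_star_self_nonneg w
    have hs0 : (0 : ℂ) < (s : ℂ) := by exact_mod_cast h0
    have h4 : (s : ℂ) * (star w ⬝ᵥ w) = 0 :=
      le_antisymm (by rw [← h1]; exact le_add_of_nonneg_left h2) (mul_nonneg hs0.le h3)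
    exact (mul_eq_zero.1 h4).resolve_left hs0.ne'
  have hσv : σ *ᵥ v = (s : ℂ) • v := sub_eq_zero.1 (dotProduct_star_self_eq_zero.1 hww)
  rw [hσv, dotProduct_smul, hv1]
  simp

end TraceNorm

/-! ### Heisenberg duals, Duhamel's formula and stability of expectation values -/

section Lindbladian

open Matrix

variable {n : Type*} [Fintype n]

theorem IsCPTP.posSemidef_apply {T : SuperOp n} (hT : IsCPTP T) {Y : Matrix n n ℂ}
    (hY : Y.PosSemidef) : (T Y).PosSemidef := by
  have h := (hT.completelyPositive 1 (Y.submatrix Prod.fst Prod.fst)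
    (hY.submatrix Prod.fst)).submatrix fun i : n ↦ (i, (0 : Fin 1))
  exact h

variable [DecidableEq n]

theorem SuperOp.exists_dual (T : SuperOp n) (Φ : Matrix n n ℂ) :
    ∃ W : Matrix n n ℂ, ∀ Y, (W * Y).trace = (Φ * T Y).trace := by
  refine ⟨Matrix.of fun i j ↦ (Φ * T (Matrix.single j i 1)).trace, fun Y ↦ ?_⟩
  have hY : T Y = ∑ i, ∑ j, Y i j • T (Matrix.single i j 1) := by
    conv_lhs => rw [Matrix.matrix_eq_sum_single Y]
    simp_rw [map_sum]
    refine Finset.sum_congr rfl fun i _ ↦ Finset.sum_congr rfl fun j _ ↦ ?_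
    rw [← map_smul, Matrix.smul_single, smul_eq_mul, mul_one]
  rw [hY]
  simp_rw [Matrix.mul_sum, Matrix.trace_sum, Matrix.mul_smul, Matrix.trace_smul, smul_eq_mul]
  rw [Finset.sum_comm]
  simp only [Matrix.trace, Matrix.diag_apply, Matrix.mul_apply, Matrix.of_apply, mul_comm]

/-- Test on rank-one matrices: `⟨x, W x⟩ = Tr(Φ T(x x†)) ≥ 0`. -/
theorem IsCPTP.posSemidef_dual {T : SuperOp n} (hT : IsCPTP T) {Φ W : Matrix n n ℂ}
    (hΦ : Φ.PosSemidef) (hW : ∀ Y, (W * Y).trace = (Φ * T Y).trace) : W.PosSemidef := by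
  apply Matrix.posSemidef_of_complex_dotProduct_mulVec_nonneg
  intro x
  have h : star x ⬝ᵥ (W *ᵥ x) = (W * vecMulVec x (star x)).trace := by
    rw [Matrix.mul_vecMulVec, Matrix.trace_vecMulVec, dotProduct_comm]
  rw [h, hW]
  exact hΦ.trace_mul_nonneg (hT.posSemidef_apply (Matrix.posSemidef_vecMulVec_self_star x))

/-- The Heisenberg dual of a CPTP map preserves the order interval `[-1, 1]`. -/
theorem IsCPTP.exists_dual_mem_unit_interval {T : SuperOp n} (hT : IsCPTP T) {Φ : Matrix n n ℂ}
    (h₁ : (1 - Φ).PosSemidef) (h₂ : (1 + Φ).PosSemidef) :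
    ∃ W : Matrix n n ℂ, (1 - W).PosSemidef ∧ (1 + W).PosSemidef ∧
      ∀ Y, (W * Y).trace = (Φ * T Y).trace := by
  obtain ⟨W, hW⟩ := SuperOp.exists_dual T Φ
  -- By trace preservation the dual fixes `1`, so `1 ∓ W` is dual to `1 ∓ Φ`.
  refine ⟨W, hT.posSemidef_dual h₁ fun Y ↦ ?_, hT.posSemidef_dual h₂ fun Y ↦ ?_, hW⟩
  · rw [Matrix.sub_mul, Matrix.sub_mul, Matrix.trace_sub, Matrix.trace_sub, hW, Matrix.one_mul,
      Matrix.one_mul, hT.tracePreserving]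
  · rw [Matrix.add_mul, Matrix.add_mul, Matrix.trace_add, Matrix.trace_add, hW, Matrix.one_mul,
      Matrix.one_mul, hT.tracePreserving]

/-- In the product rule `a` and `b` are both placed between the exponentials, each commuting with
its own, so the two terms merge into one containing `b - a`. -/
theorem hasDerivAt_linearMap_exp_mul_exp {𝔸 : Type*} [NormedRing 𝔸] [NormedAlgebra ℝ 𝔸]
    [FiniteDimensional ℝ 𝔸] (ℓ : 𝔸 →ₗ[ℝ] ℝ) (a b : 𝔸) (t s : ℝ) :
    HasDerivAt (fun s : ℝ ↦ ℓ (NormedSpace.exp ((t - s) • a) * NormedSpace.exp (s • b)))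
      (ℓ (NormedSpace.exp ((t - s) • a) * ((b - a) * NormedSpace.exp (s • b)))) s := by
  have : CompleteSpace 𝔸 := FiniteDimensional.complete ℝ 𝔸
  have h1 := (hasDerivAt_exp_smul_const (𝕂 := ℝ) a (t - s)).scomp s
    ((hasDerivAt_const s t).sub (hasDerivAt_id s))
  have h2 := hasDerivAt_exp_smul_const' (𝕂 := ℝ) b s
  have h3 := (LinearMap.toContinuousLinearMap ℓ).hasFDerivAt.comp_hasDerivAt s (h1.mul h2)
  refine h3.congr_deriv ?_
  change ℓ _ = ℓ _
  congr 1
  simp only [Function.comp_apply]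
  rw [zero_sub, neg_one_smul]
  noncomm_ring

/-- Continuity of the exponential composed with a linear map, in a finite-dimensional algebra. -/
theorem continuous_linearMap_exp {𝔸 : Type*} [NormedRing 𝔸] [NormedAlgebra ℝ 𝔸]
    [FiniteDimensional ℝ 𝔸] {Z : Type*} [TopologicalSpace Z] (ℓ : 𝔸 →ₗ[ℝ] ℝ) {ι : Type*}
    [Fintype ι] (a : 𝔸) (b : ι → 𝔸) {c : ι → Z → ℝ} (hc : ∀ i, Continuous (c i)) :
    Continuous fun z ↦ ℓ (NormedSpace.exp (a + ∑ i, c i z • b i)) := by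
  have : CompleteSpace 𝔸 := FiniteDimensional.complete ℝ 𝔸
  let : NormedAlgebra ℚ 𝔸 := NormedAlgebra.restrictScalars ℚ ℝ 𝔸
  have hℓ : Continuous ℓ := LinearMap.continuous_of_finiteDimensional ℓ
  refine hℓ.comp (NormedSpace.exp_continuous.comp ?_)
  fun_prop

/-- The real-linear functional `A ↦ Re Tr(Φ A(ρ))`, on superoperators written as matrices. -/
noncomputable def expectationFunctional (Φ ρ : Matrix n n ℂ) :
    Matrix (n × n) (n × n) ℂ →ₗ[ℝ] ℝ where
  toFun A := (Φ * ((LinearMap.toMatrixAlgEquiv (Matrix.stdBasis ℂ n n)).symm A) ρ).trace.re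
  map_add' A B := by simp [Matrix.mul_add]
  map_smul' c A := by
    rw [← Complex.coe_smul c A, map_smul, LinearMap.smul_apply, Matrix.mul_smul,
      Matrix.trace_smul]
    simp

theorem expectationFunctional_apply (Φ ρ : Matrix n n ℂ) (A : Matrix (n × n) (n × n) ℂ) :
    expectationFunctional Φ ρ A =
      (Φ * ((LinearMap.toMatrixAlgEquiv (Matrix.stdBasis ℂ n n)).symm A) ρ).trace.re :=
  rfl

open scoped Matrix.Norms.Operator in
/-- Duhamel's principle for an expectation value along the interpolation
`s ↦ e^{(t-s)L} e^{sL'}`. -/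
theorem hasDerivAt_re_trace_semigroup_mul_semigroup (L L' : SuperOp n) (Φ ρ : Matrix n n ℂ)
    (t s : ℝ) :
    HasDerivAt (fun s : ℝ ↦ (Φ * semigroup L (t - s) (semigroup L' s ρ)).trace.re)
      (Φ * semigroup L (t - s) ((L' - L) (semigroup L' s ρ))).trace.re s := by
  set ψ := LinearMap.toMatrixAlgEquiv (Matrix.stdBasis ℂ n n) with hψ
  have h := hasDerivAt_linearMap_exp_mul_exp (expectationFunctional Φ ρ) (ψ L) (ψ L') t s
  have hsem : ∀ (L : SuperOp n) (r : ℝ), semigroup L r = ψ.symm (NormedSpace.exp (r • ψ L)) := by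
    intro L r
    rw [semigroup, Complex.coe_smul]
  simp only [expectationFunctional_apply, map_mul, ← hψ, ← map_sub ψ,
    AlgEquiv.symm_apply_apply] at h
  simp_rw [hsem]
  exact h

theorem semigroup_zero (L : SuperOp n) : semigroup L 0 = 1 := by
  simp [semigroup]

/-- The expectation value of an observable `-1 ≤ Φ ≤ 1` is Lipschitz in the generator. -/
theorem abs_re_trace_semigroup_sub_le {L L' : SuperOp n} (hL : IsLindbladian L)
    (hL' : IsLindbladian L') {Φ ρ : Matrix n n ℂ} (h₁ : (1 - Φ).PosSemidef)
    (h₂ : (1 + Φ).PosSemidef) (hρ : ρ.PosSemidef) (hρ1 : ρ.trace = 1) {B t : ℝ} (ht : 0 ≤ t)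
    (hB : ∀ W σ : Matrix n n ℂ, (1 - W).PosSemidef → (1 + W).PosSemidef → σ.PosSemidef →
      σ.trace = 1 → |(W * (L' - L) σ).trace.re| ≤ B) :
    |(Φ * semigroup L' t ρ).trace.re - (Φ * semigroup L t ρ).trace.re| ≤ B * t := by
  have h := norm_image_sub_le_of_norm_deriv_le_segment' (a := 0) (b := t) (C := B)
    (f := fun s : ℝ ↦ (Φ * semigroup L (t - s) (semigroup L' s ρ)).trace.re)
    (fun s _ ↦ (hasDerivAt_re_trace_semigroup_mul_semigroup L L' Φ ρ t s).hasDerivWithinAt)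
    (fun s hs ↦ ?_) t (Set.right_mem_Icc.2 ht)
  · simpa [semigroup_zero] using h
  -- The derivative pairs `L' - L` with the evolved observable `W` and the evolved state, which both
  -- stay in the classes covered by `hB`.
  · obtain ⟨W, hW₁, hW₂, hW⟩ :=
      (hL (t - s) (by linarith [hs.2])).exists_dual_mem_unit_interval h₁ h₂
    rw [← hW]
    exact hB W _ hW₁ hW₂ ((hL' s hs.1).posSemidef_apply hρ)
      (by rw [(hL' s hs.1).tracePreserving, hρ1])

theorem one_le_traceNorm {σ : Matrix n n ℂ} (hσ1 : σ.trace = 1) : 1 ≤ traceNorm σ := by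
  have := re_trace_mul_le_traceNorm (W := (1 : Matrix n n ℂ))
    (by simpa using Matrix.PosSemidef.zero) (Matrix.PosSemidef.one.add Matrix.PosSemidef.one) σ
  simpa [hσ1] using this

theorem traceNorm_apply_le_of_oneToOneNorm_le {T : SuperOp n} {C : ℝ} (hC : 0 ≤ C)
    (hT : oneToOneNorm T ≤ ENNReal.ofReal C) {σ : Matrix n n ℂ} (hσ : σ.PosSemidef)
    (hσ1 : σ.trace = 1) : traceNorm (T σ) ≤ C := by
  have hn : traceNorm σ = 1 :=
    le_antisymm (by simpa [hσ1] using traceNorm_le_re_trace hσ) (one_le_traceNorm hσ1)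
  have hne : σ ≠ 0 := by
    rintro rfl
    simp at hσ1
  have h1 : ENNReal.ofReal (traceNorm (T σ) / traceNorm σ) ≤ ENNReal.ofReal C :=
    (le_iSup₂ (f := fun (Y : Matrix n n ℂ) (_ : Y ≠ 0) ↦
      ENNReal.ofReal (traceNorm (T Y) / traceNorm Y)) σ hne).trans hT
  rw [hn, div_one] at h1
  exact (ENNReal.ofReal_le_ofReal_iff hC).1 h1

end Lindbladian

/-! ### Lipschitz dependence of the output distribution on the parameter -/

namespace LindbladianEnsemble

open Matrix

variable {n X : Type*} [Fintype n] [DecidableEq n] [Fintype X] {M : ℕ} {δ C_G : ℝ}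

theorem L_sub_L_apply (E : LindbladianEnsemble n X M δ C_G) (θ θ' : ParamSphere M)
    (σ : Matrix n n ℂ) :
    (E.L θ' - E.L θ) σ =
      ((δ / √M : ℝ) : ℂ) • ∑ j, ((θ'.1 j - θ.1 j : ℝ) : ℂ) • E.G j σ := by
  change E.L θ' σ - E.L θ σ = _
  simp only [L, LinearMap.add_apply, LinearMap.smul_apply, LinearMap.sum_apply,
    add_sub_add_left_eq_sub, Complex.ofReal_sub, sub_smul, Finset.sum_sub_distrib, smul_sub]

theorem abs_re_trace_mul_L_sub_L_le (E : LindbladianEnsemble n X M δ C_G) (hδ : 0 ≤ δ)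
    (hC : 0 ≤ C_G) (θ θ' : ParamSphere M) {W σ : Matrix n n ℂ} (h₁ : (1 - W).PosSemidef)
    (h₂ : (1 + W).PosSemidef) (hσ : σ.PosSemidef) (hσ1 : σ.trace = 1) :
    |(W * (E.L θ' - E.L θ) σ).trace.re| ≤ δ * C_G * dist θ' θ := by
  have h : (W * (E.L θ' - E.L θ) σ).trace.re =
      δ / √M * ∑ j, (θ'.1 j - θ.1 j) * (W * E.G j σ).trace.re := by
    rw [L_sub_L_apply]
    simp only [Matrix.mul_smul, Matrix.trace_smul,
      Matrix.mul_sum, Matrix.trace_sum, smul_eq_mul, Complex.re_ofReal_mul, Complex.re_sum]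
  have hcs : ∑ j, |θ'.1 j - θ.1 j| ≤ √M * dist θ' θ := by
    rw [Subtype.dist_eq, EuclideanSpace.dist_eq, ← Real.sqrt_mul (Nat.cast_nonneg M)]
    apply Real.le_sqrt_of_sq_le
    have := sq_sum_le_card_mul_sum_sq (s := Finset.univ) (f := fun j ↦ |θ'.1 j - θ.1 j|)
    simpa [Real.dist_eq] using this
  -- Only an inequality, because at `M = 0` division by zero makes the left side `0`.
  have hM : δ / √M * √M ≤ δ := by
    rcases eq_or_ne (√(M : ℝ)) 0 with h0 | h0
    · simpa [h0] using hδ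
    · rw [div_mul_cancel₀ _ h0]
  rw [h, abs_mul, abs_of_nonneg (by positivity)]
  calc δ / √M * |∑ j, (θ'.1 j - θ.1 j) * (W * E.G j σ).trace.re|
      ≤ δ / √M * ∑ j, |θ'.1 j - θ.1 j| * C_G := by
        gcongr
        refine (Finset.abs_sum_le_sum_abs _ _).trans (Finset.sum_le_sum fun j _ ↦ ?_)
        rw [abs_mul]
        gcongr
        exact (abs_re_trace_mul_le_traceNorm h₁ h₂ _).trans
          (traceNorm_apply_le_of_oneToOneNorm_le hC (E.norm_G_le j) hσ hσ1)
    _ ≤ δ / √M * ((√M * dist θ' θ) * C_G) := by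
        rw [← Finset.sum_mul]
        gcongr
    _ = (δ / √M * √M) * (C_G * dist θ' θ) := by ring
    _ ≤ δ * (C_G * dist θ' θ) := by gcongr
    _ = _ := by ring

/-- The observable `∑ φ(x) M_x` of a query. -/
noncomputable def observable (E : LindbladianEnsemble n X M δ C_G) (φ : X → ℝ) : Matrix n n ℂ :=
  ∑ x, ((φ x : ℝ) : ℂ) • E.povm x

theorem posSemidef_one_sub_observable (E : LindbladianEnsemble n X M δ C_G) {φ : X → ℝ}
    (hφ : ∀ x, φ x ≤ 1) : (1 - E.observable φ).PosSemidef := by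
  have : 1 - E.observable φ = ∑ x, ((1 - φ x : ℝ) : ℂ) • E.povm x := by
    rw [observable, ← E.sum_povm, ← Finset.sum_sub_distrib]
    simp [sub_smul]
  rw [this]
  refine Matrix.posSemidef_sum _ fun x _ ↦ (E.posSemidef_povm x).smul ?_
  exact_mod_cast sub_nonneg.2 (hφ x)

theorem posSemidef_one_add_observable (E : LindbladianEnsemble n X M δ C_G) {φ : X → ℝ}
    (hφ : ∀ x, -1 ≤ φ x) : (1 + E.observable φ).PosSemidef := by
  have := E.posSemidef_one_sub_observable (φ := fun x ↦ -φ x) fun x ↦ by linarith [hφ x]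
  simpa [observable] using this

theorem expect_outDist (E : LindbladianEnsemble n X M δ C_G) (t : ℝ) (θ : ParamSphere M)
    (φ : Query X) :
    expect (E.outDist t θ) φ = (E.observable φ.1 * semigroup (E.L θ) t E.ρ).trace.re := by
  rw [expect, observable, Matrix.sum_mul, Matrix.trace_sum, Complex.re_sum]
  refine Finset.sum_congr rfl fun x _ ↦ ?_
  rw [Matrix.smul_mul, Matrix.trace_smul, smul_eq_mul, Complex.re_ofReal_mul, outDist]

theorem abs_expect_outDist_sub_le (E : LindbladianEnsemble n X M δ C_G) (hδ : 0 ≤ δ)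
    (hC : 0 ≤ C_G) {t : ℝ} (ht : 0 ≤ t) {θ θ' : ParamSphere M} (hθ : θ ∈ E.Θ) (hθ' : θ' ∈ E.Θ)
    (φ : Query X) :
    |expect (E.outDist t θ') φ - expect (E.outDist t θ) φ| ≤ t * δ * C_G * dist θ' θ := by
  rw [expect_outDist, expect_outDist]
  refine (abs_re_trace_semigroup_sub_le (E.lindbladian_of_mem θ hθ) (E.lindbladian_of_mem θ' hθ')
    (E.posSemidef_one_sub_observable fun x ↦ (φ.2 x).2)
    (E.posSemidef_one_add_observable fun x ↦ (φ.2 x).1) E.posSemidef_ρ E.trace_ρ ht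
    fun W σ h₁ h₂ hσ hσ1 ↦ E.abs_re_trace_mul_L_sub_L_le hδ hC θ θ' h₁ h₂ hσ hσ1).trans_eq ?_
  ring

open scoped Matrix.Norms.Operator in
-- Holds on the whole sphere, also where `L(θ)` is not a Lindbladian, and so gives measurability and
-- integrability outright.
theorem continuous_outDist (E : LindbladianEnsemble n X M δ C_G) (t : ℝ) (x : X) :
    Continuous fun θ ↦ E.outDist t θ x := by
  set ψ := LinearMap.toMatrixAlgEquiv (Matrix.stdBasis ℂ n n) with hψ
  have h := continuous_linearMap_exp (Z := ParamSphere M)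
    (expectationFunctional (E.povm x) E.ρ) (t • ψ E.Lref) (fun j ↦ ψ (E.G j))
    (c := fun j θ ↦ t * (δ / √M) * θ.1 j) (fun j ↦ by fun_prop)
  have hL : ∀ θ : ParamSphere M, (t : ℂ) • ψ (E.L θ) =
      t • ψ E.Lref + ∑ j, (t * (δ / √M) * θ.1 j) • ψ (E.G j) := by
    intro θ
    simp only [L, map_add, map_smul, map_sum, smul_add, Finset.smul_sum, smul_smul,
      ← Complex.coe_smul]
    push_cast
    simp only [mul_assoc]
  simp only [expectationFunctional_apply, ← hψ, ← hL] at h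
  exact h

end LindbladianEnsemble

/-! ### Total variation distance and queries -/

section TotalVariation

variable {X : Type*} [Fintype X]

theorem tvDist_comm (P Q : X → ℝ) : tvDist P Q = tvDist Q P := by
  simp only [tvDist, abs_sub_comm]

theorem tvDist_triangle (P Q R : X → ℝ) : tvDist P R ≤ tvDist P Q + tvDist Q R := by
  rw [tvDist, tvDist, tvDist, ← mul_add, ← Finset.sum_add_distrib]
  gcongr
  exact abs_sub_le _ _ _

/-- The optimal query is the sign of `P - Q`. -/
theorem exists_query_expect_sub_eq (P Q : X → ℝ) :
    ∃ φ : Query X, expect P φ - expect Q φ = 2 * tvDist P Q := by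
  classical
  refine ⟨⟨fun x ↦ if Q x ≤ P x then 1 else -1, fun x ↦ ?_⟩, ?_⟩
  · dsimp only
    split_ifs <;> norm_num
  · rw [expect, expect, ← Finset.sum_sub_distrib, tvDist, ← mul_assoc, mul_one_div_cancel two_ne_zero,
      one_mul]
    refine Finset.sum_congr rfl fun x _ ↦ ?_
    dsimp only
    split_ifs with h
    · rw [abs_of_nonneg (by linarith)]
      ring
    · rw [abs_of_neg (by linarith)]
      ring

theorem abs_expect_sub_le (P Q : X → ℝ) (φ : Query X) :
    |expect P φ - expect Q φ| ≤ 2 * tvDist P Q := by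
  rw [expect, expect, ← Finset.sum_sub_distrib, tvDist, ← mul_assoc, mul_one_div_cancel two_ne_zero,
    one_mul]
  refine (Finset.abs_sum_le_sum_abs _ _).trans (Finset.sum_le_sum fun x _ ↦ ?_)
  rw [← mul_sub, abs_mul]
  exact mul_le_of_le_one_left (abs_nonneg _) (abs_le.2 (φ.2 x))

end TotalVariation

/-! ### Statistical query lower bounds from concentration -/

section StatisticalQueries

variable {X : Type*} [Fintype X]

/-- Running `A` with the exact oracle of `Q` for at most `q` further queries, either some query
separates `P` from `Q` by more than `τ`, or the hypothesis is `ε`-close to `P`. -/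
def SQAlgorithm.Detects (A : SQAlgorithm X) (Q : X → ℝ) (τ ε : ℝ) (P : X → ℝ) :
    (q k : ℕ) → (Fin k → ℝ) → Prop
  | 0, k, h => Sum.elim (fun _ ↦ False) (fun R ↦ tvDist R.1 P < ε) (A k h)
  | q + 1, k, h => Sum.elim
      (fun φ ↦ τ < |expect P φ - expect Q φ| ∨
        SQAlgorithm.Detects A Q τ ε P q (k + 1) (Fin.snoc h (expect Q φ)))
      (fun R ↦ tvDist R.1 P < ε) (A k h)

open Classical in
/-- The oracle for `P` that answers as if the distribution were `Q` whenever this is admissible. -/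
noncomputable def maskedOracle (τ : ℝ) (Q P : X → ℝ) (φ : Query X) : ℝ :=
  if |expect P φ - expect Q φ| ≤ τ then expect Q φ else expect P φ

theorem isStatOracle_maskedOracle {τ : ℝ} (hτ : 0 ≤ τ) (Q P : X → ℝ) :
    IsStatOracle τ P (maskedOracle τ Q P) := by
  intro φ
  rw [maskedOracle]
  split_ifs with h
  · rwa [abs_sub_comm]
  · simpa using hτ

theorem measurable_expect (P : X → ℝ) : Measurable (expect P) := by
  unfold expect
  exact Finset.measurable_sum _ fun x _ ↦
    ((measurable_pi_apply x).comp measurable_subtype_coe).mul_const _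

theorem measurable_maskedOracle (τ : ℝ) (Q P : X → ℝ) : Measurable (maskedOracle τ Q P) := by
  classical
  unfold maskedOracle
  refine Measurable.ite ?_ (measurable_expect Q) (measurable_expect P)
  exact measurableSet_le (((measurable_expect P).sub (measurable_expect Q)).abs) measurable_const

/-- Until a query separates `P` from `Q`, the masked oracle answers exactly as `Q` does, so both
runs have the same transcript. -/
theorem SQAlgorithm.detects_of_run_maskedOracle (A : SQAlgorithm X) (Q : X → ℝ) {τ ε : ℝ}
    (P : X → ℝ) {R : stdSimplex ℝ X} (hR : tvDist R.1 P < ε) :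
    ∀ (q k : ℕ) (h : Fin k → ℝ), A.run (maskedOracle τ Q P) q k h = some R →
      A.Detects Q τ ε P q k h
  | 0, k, h, hrun => by
    rw [SQAlgorithm.run] at hrun
    rw [SQAlgorithm.Detects]
    cases hA : A k h with
    | inl φ => simp [hA] at hrun
    | inr S =>
      simp only [hA, Option.some.injEq] at hrun
      rw [Sum.elim_inr, hrun]
      exact hR
  | q + 1, k, h, hrun => by
    rw [SQAlgorithm.run] at hrun
    rw [SQAlgorithm.Detects]
    cases hA : A k h with
    | inl φ =>
      simp only [hA] at hrun
      rw [Sum.elim_inl]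
      by_cases hφ : |expect P φ - expect Q φ| ≤ τ
      · right
        rw [maskedOracle, if_pos hφ] at hrun
        exact SQAlgorithm.detects_of_run_maskedOracle A Q P hR q (k + 1) _ hrun
      · left
        exact not_le.1 hφ
    | inr S =>
      simp only [hA, Option.some.injEq] at hrun
      rw [Sum.elim_inr, hrun]
      exact hR

theorem SQAlgorithm.Succeeds.detects {A : SQAlgorithm X} {Q P : X → ℝ} {τ ε : ℝ} {q : ℕ}
    (h : A.Succeeds (maskedOracle τ Q P) ε q P) : A.Detects Q τ ε P q 0 Fin.elim0 := by
  obtain ⟨R, hrun, hR⟩ := h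
  exact A.detects_of_run_maskedOracle Q P hR q 0 _ hrun

section Measure

variable {T : Type*} [MeasurableSpace T] {μ : Measure T} {P : T → X → ℝ} {Q : X → ℝ}
  {τ ε η : ℝ}

/-- The run with answers from `Q` does not depend on `θ`, so this is a union bound over at most `q`
fixed queries and one fixed hypothesis. -/
theorem SQAlgorithm.measureReal_detects_le [IsFiniteMeasure μ] (A : SQAlgorithm X) (hη : 0 ≤ η)
    (hquery : ∀ φ : Query X, μ.real {θ | τ < |expect (P θ) φ - expect Q φ|} ≤ η)
    (hball : ∀ R : stdSimplex ℝ X, μ.real {θ | tvDist R.1 (P θ) < ε} ≤ η) :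
    ∀ (q k : ℕ) (h : Fin k → ℝ),
      μ.real {θ | A.Detects Q τ ε (P θ) q k h} ≤ (q + 1) * η
  | 0, k, h => by
    simp only [SQAlgorithm.Detects]
    cases A k h with
    | inl φ => simpa using hη
    | inr R => simpa using hball R
  | q + 1, k, h => by
    simp only [SQAlgorithm.Detects]
    push_cast
    cases A k h with
    | inl φ =>
      simp only [Sum.elim_inl]
      rw [Set.ofPred_or]
      refine (measureReal_union_le _ _).trans ?_
      have h1 := SQAlgorithm.measureReal_detects_le A hη hquery hball q (k + 1)
        (Fin.snoc h (expect Q φ))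
      linarith [hquery φ]
    | inr R =>
      simp only [Sum.elim_inr]
      have : 0 ≤ (q : ℝ) * η := by positivity
      linarith [hball R]

theorem measurable_expect_prod (hP : ∀ x, Measurable fun θ ↦ P θ x) :
    Measurable fun p : Query X × T ↦ expect (P p.2) p.1 := by
  unfold expect
  exact Finset.measurable_sum _ fun x _ ↦
    (((measurable_pi_apply x).comp measurable_subtype_coe).comp measurable_fst).mul
      ((hP x).comp measurable_snd)

theorem measurable_tvDist_prod (hP : ∀ x, Measurable fun θ ↦ P θ x) :
    Measurable fun p : stdSimplex ℝ X × T ↦ tvDist p.1.1 (P p.2) := by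
  unfold tvDist
  refine (Finset.measurable_sum _ fun x _ ↦ ?_).const_mul _
  exact ((((measurable_pi_apply x).comp measurable_subtype_coe).comp measurable_fst).sub
    ((hP x).comp measurable_snd)).abs

theorem measurableSet_sumElim {α β γ : Type*} [MeasurableSpace α] [MeasurableSpace β]
    [MeasurableSpace γ] {a : γ → α ⊕ β} (ha : Measurable a) {p : α → γ → Prop} {r : β → γ → Prop}
    (hp : MeasurableSet {z : α × γ | p z.1 z.2}) (hr : MeasurableSet {z : β × γ | r z.1 z.2}) :
    MeasurableSet {c : γ | Sum.elim (fun x ↦ p x c) (fun y ↦ r y c) (a c)} := by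
  have hD : MeasurableSet {s : (α × γ) ⊕ (β × γ) |
      Sum.elim (fun z ↦ p z.1 z.2) (fun z ↦ r z.1 z.2) s} :=
    measurableSet_sum_iff.2 ⟨hp, hr⟩
  have hm : Measurable fun c ↦ MeasurableEquiv.sumProdDistrib α β γ (a c, c) :=
    (MeasurableEquiv.sumProdDistrib α β γ).measurable.comp (ha.prodMk measurable_id)
  convert hm hD using 1
  ext c
  simp only [Set.mem_ofPred_eq, Set.mem_preimage]
  cases h : a c <;> rfl

/-- Joint measurability in seed and parameter is what Tonelli needs. The past answers are kept as a
variable so that the induction on `q` can extend them. -/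
theorem RandomizedSQAlgorithm.measurableSet_detects {Ω : Type*} [MeasurableSpace Ω]
    (A : RandomizedSQAlgorithm Ω X) (hP : ∀ x, Measurable fun θ ↦ P θ x) (q : ℕ) :
    ∀ k : ℕ, MeasurableSet {z : (Ω × (Fin k → ℝ)) × T |
      (A.alg z.1.1).Detects Q τ ε (P z.2) q k z.1.2} := by
  have hball : ∀ k, MeasurableSet {z : stdSimplex ℝ X × ((Ω × (Fin k → ℝ)) × T) |
      tvDist z.1.1 (P z.2.2) < ε} := fun k ↦
    measurableSet_lt ((measurable_tvDist_prod hP).comp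
      (measurable_fst.prodMk (measurable_snd.comp measurable_snd))) measurable_const
  have hquery : ∀ k, MeasurableSet {z : Query X × ((Ω × (Fin k → ℝ)) × T) |
      τ < |expect (P z.2.2) z.1 - expect Q z.1|} := by
    intro k
    have h1 : Measurable fun z : Query X × ((Ω × (Fin k → ℝ)) × T) ↦ expect (P z.2.2) z.1 :=
      (measurable_expect_prod hP).comp (measurable_fst.prodMk (measurable_snd.comp measurable_snd))
    have h2 : Measurable fun z : Query X × ((Ω × (Fin k → ℝ)) × T) ↦ expect Q z.1 :=
      (measurable_expect Q).comp measurable_fst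
    exact measurableSet_lt measurable_const (h1.sub h2).abs
  have halg : ∀ k, Measurable fun z : (Ω × (Fin k → ℝ)) × T ↦ A.alg z.1.1 k z.1.2 := fun k ↦
    (A.measurable_alg k).comp measurable_fst
  induction q with
  | zero =>
    intro k
    simp only [SQAlgorithm.Detects]
    exact measurableSet_sumElim (p := fun _ _ ↦ False)
      (r := fun R z ↦ tvDist R.1 (P z.2) < ε) (halg k) (by simp) (hball k)
  | succ q ih =>
    intro k
    simp only [SQAlgorithm.Detects]
    let f : Query X × ((Ω × (Fin k → ℝ)) × T) → (Ω × (Fin (k + 1) → ℝ)) × T :=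
      fun z ↦ ((z.2.1.1, Fin.snoc z.2.1.2 (expect Q z.1)), z.2.2)
    have hf : Measurable f := by
      have hsnoc : Measurable fun z : Query X × ((Ω × (Fin k → ℝ)) × T) ↦
          (Fin.snoc z.2.1.2 (expect Q z.1) : Fin (k + 1) → ℝ) := by
        refine measurable_pi_iff.2 fun i ↦ ?_
        refine Fin.lastCases ?_ (fun j ↦ ?_) i
        · simp only [Fin.snoc_last]
          exact (measurable_expect Q).comp measurable_fst
        · simp only [Fin.snoc_castSucc]
          fun_prop
      have hω : Measurable fun z : Query X × ((Ω × (Fin k → ℝ)) × T) ↦ z.2.1.1 := by fun_prop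
      have hθ : Measurable fun z : Query X × ((Ω × (Fin k → ℝ)) × T) ↦ z.2.2 := by fun_prop
      exact (hω.prodMk hsnoc).prodMk hθ
    have hnext := measurableSet_preimage hf (ih (k + 1))
    exact measurableSet_sumElim
      (p := fun φ z ↦ τ < |expect (P z.2) φ - expect Q φ| ∨ (A.alg z.1.1).Detects Q τ ε (P z.2)
        q (k + 1) (Fin.snoc z.1.2 (expect Q φ)))
      (r := fun R z ↦ tvDist R.1 (P z.2) < ε)
      (halg k) ((hquery k).union hnext) (hball k)

/-- The query lower bound for deterministic algorithms, from the two concentration estimates. -/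
theorem SQAlgorithm.measureReal_learns_le [IsFiniteMeasure μ] (A : SQAlgorithm X) (hη : 0 ≤ η)
    (hτ : 0 ≤ τ)
    (hquery : ∀ φ : Query X, μ.real {θ | τ < |expect (P θ) φ - expect Q φ|} ≤ η)
    (hball : ∀ R : stdSimplex ℝ X, μ.real {θ | tvDist R.1 (P θ) < ε} ≤ η) (q : ℕ) :
    μ.real {θ | A.Learns ε τ q (P θ)} ≤ (q + 1) * η := by
  refine (measureReal_mono fun θ hθ ↦ ?_).trans
    (A.measureReal_detects_le hη hquery hball q 0 Fin.elim0)
  exact (hθ _ (isStatOracle_maskedOracle hτ Q (P θ))).detects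

/-- The query lower bound for randomized algorithms, from the two concentration estimates. -/
theorem RandomizedSQAlgorithm.mul_measureReal_learns_le {Ω : Type*} [MeasurableSpace Ω]
    {ℙ : Measure Ω} [IsProbabilityMeasure ℙ] [IsFiniteMeasure μ] (A : RandomizedSQAlgorithm Ω X)
    (hP : ∀ x, Measurable fun θ ↦ P θ x) (hη : 0 ≤ η) (hτ : 0 ≤ τ) {α : ℝ} (hα : 0 ≤ α)
    (hquery : ∀ φ : Query X, μ.real {θ | τ < |expect (P θ) φ - expect Q φ|} ≤ η)
    (hball : ∀ R : stdSimplex ℝ X, μ.real {θ | tvDist R.1 (P θ) < ε} ≤ η) (q : ℕ) :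
    α * μ.real {θ | A.Learns ℙ α ε τ q (P θ)} ≤ (q + 1) * η := by
  set H : Set (T × Ω) := {p | (A.alg p.2).Detects Q τ ε (P p.1) q 0 Fin.elim0} with hH
  have hHm : MeasurableSet H := by
    have h := A.measurableSet_detects (Q := Q) (τ := τ) (ε := ε) hP q 0
    exact ((measurable_snd.prodMk measurable_const).prodMk measurable_fst :
      Measurable fun p : T × Ω ↦ ((p.2, (Fin.elim0 : Fin 0 → ℝ)), p.1)) h
  -- Only an inclusion is needed, so the learning set itself need not be measurable.
  have hsub : {θ | A.Learns ℙ α ε τ q (P θ)} ⊆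
      {θ | ENNReal.ofReal α ≤ ℙ (Prod.mk θ ⁻¹' H)} := by
    intro θ hθ
    have h1 := hθ _ (measurable_maskedOracle τ Q (P θ)) (isStatOracle_maskedOracle hτ Q (P θ))
    have h2 : α ≤ ℙ.real (Prod.mk θ ⁻¹' H) :=
      h1.trans (measureReal_mono fun ω hω ↦ SQAlgorithm.Succeeds.detects hω)
    exact ENNReal.ofReal_le_of_le_toReal h2
  have hint : ∫⁻ θ, ℙ (Prod.mk θ ⁻¹' H) ∂μ ≤ ENNReal.ofReal ((q + 1) * η) := by
    -- Exchanging the integrals fixes the seed, and the deterministic bound applies to each seed.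
    rw [← Measure.prod_apply hHm, Measure.prod_apply_symm hHm]
    calc ∫⁻ ω, μ ((fun θ ↦ (θ, ω)) ⁻¹' H) ∂ℙ ≤ ∫⁻ _, ENNReal.ofReal ((q + 1) * η) ∂ℙ := by
          refine lintegral_mono fun ω ↦ ?_
          rw [← ofReal_measureReal]
          exact ENNReal.ofReal_le_ofReal
            ((A.alg ω).measureReal_detects_le hη hquery hball q 0 Fin.elim0)
      _ = _ := by simp
  have hmarkov := mul_meas_ge_le_lintegral (μ := μ)
    (measurable_measure_prodMk_left (ν := ℙ) hHm) (ENNReal.ofReal α)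
  have hfin := (mul_le_mul_right (measure_mono (μ := μ) hsub) (ENNReal.ofReal α)).trans
    (hmarkov.trans hint)
  rw [← ofReal_measureReal, ← ENNReal.ofReal_mul hα] at hfin
  exact (ENNReal.ofReal_le_ofReal_iff (by positivity)).1 hfin

end Measure

end StatisticalQueries

/-! ### Concentration in the ensemble and the final bounds -/

namespace LindbladianEnsemble

variable {n X : Type*} [Fintype n] [DecidableEq n] [Fintype X] {M : ℕ} {δ C_G : ℝ}

instance isProbabilityMeasure_μ (E : LindbladianEnsemble n X M δ C_G) :
    IsProbabilityMeasure E.μ :=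
  have : IsFiniteMeasure (surfaceMeasure M) :=
    inferInstanceAs (IsFiniteMeasure (Measure.toSphere _))
  ProbabilityTheory.cond_isProbabilityMeasure E.surfaceMeasure_Θ_ne_zero

theorem integrable_outDist (E : LindbladianEnsemble n X M δ C_G) (t : ℝ) (x : X) :
    Integrable (fun θ ↦ E.outDist t θ x) E.μ :=
  (E.continuous_outDist t x).integrable_of_hasCompactSupport (HasCompactSupport.of_compactSpace _)

theorem integral_expect_outDist (E : LindbladianEnsemble n X M δ C_G) (t : ℝ) (φ : Query X) :
    ∫ θ, expect (E.outDist t θ) φ ∂E.μ = expect (E.avgDist t) φ := by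
  simp only [expect, avgDist]
  rw [integral_finsetSum _ fun x _ ↦ (E.integrable_outDist t x).const_mul _]
  simp_rw [integral_const_mul]

/-- Concentration of the value of a query around its value in the ensemble average. -/
theorem measureReal_query_le (E : LindbladianEnsemble n X M δ C_G) {t κ τ : ℝ} (ht : 0 < t)
    (hδ : 0 < δ) (hC : 0 < C_G) (hτ : 0 < τ) (hE : LevyConcentration κ E.Θ) (φ : Query X) :
    E.μ.real {θ | τ ≤ |expect (E.outDist t θ) φ - expect (E.avgDist t) φ|} ≤
      2 * Real.exp (-(κ * τ ^ 2 / (t * δ * C_G) ^ 2 * M)) := by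
  have hK : 0 < t * δ * C_G := by positivity
  obtain ⟨K, hKeq⟩ : ∃ K : ℝ≥0, (K : ℝ) = t * δ * C_G := ⟨_, Real.coe_toNNReal _ hK.le⟩
  have hlip : LipschitzOnWith K (fun θ ↦ expect (E.outDist t θ) φ) E.Θ :=
    LipschitzOnWith.of_dist_le_mul fun θ hθ θ' hθ' ↦
      hKeq ▸ E.abs_expect_outDist_sub_le hδ.le hC.le ht.le hθ' hθ φ
  have h := hE _ K (by rwa [← NNReal.coe_pos, hKeq]) hlip τ hτ
  have hint : ∫ θ, expect (E.outDist t θ) φ ∂(uniformOn E.Θ) = expect (E.avgDist t) φ :=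
    E.integral_expect_outDist t φ
  rw [hint] at h
  refine h.trans_eq ?_
  rw [hKeq]
  congr 3
  ring

/-- Concentration of the distance to the ensemble average. -/
theorem measureReal_tvDist_le (E : LindbladianEnsemble n X M δ C_G) {t κ τ : ℝ} (ht : 0 < t)
    (hδ : 0 < δ) (hC : 0 < C_G) (hτ : 0 < τ) (hE : LevyConcentration κ E.Θ) :
    E.μ.real {θ | τ / 2 ≤ |tvDist (E.outDist t θ) (E.avgDist t) - E.meanTV t|} ≤
      2 * Real.exp (-(κ * τ ^ 2 / (t * δ * C_G) ^ 2 * M)) := by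
  have hK : 0 < t * δ * C_G / 2 := by positivity
  obtain ⟨K, hKeq⟩ : ∃ K : ℝ≥0, (K : ℝ) = t * δ * C_G / 2 := ⟨_, Real.coe_toNNReal _ hK.le⟩
  have hle : ∀ θ ∈ E.Θ, ∀ θ' ∈ E.Θ, tvDist (E.outDist t θ) (E.avgDist t) -
      tvDist (E.outDist t θ') (E.avgDist t) ≤ t * δ * C_G / 2 * dist θ θ' := by
    intro θ hθ θ' hθ'
    obtain ⟨φ, hφ⟩ := exists_query_expect_sub_eq (E.outDist t θ) (E.outDist t θ')
    have h1 := (le_abs_self _).trans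
      (E.abs_expect_outDist_sub_le hδ.le hC.le ht.le hθ' hθ φ)
    have h2 := tvDist_triangle (E.outDist t θ) (E.outDist t θ') (E.avgDist t)
    linarith
  have hlip : LipschitzOnWith K
      (fun θ ↦ tvDist (E.outDist t θ) (E.avgDist t)) E.Θ :=
    LipschitzOnWith.of_dist_le_mul fun θ hθ θ' hθ' ↦ by
      rw [Real.dist_eq, hKeq]
      refine abs_sub_le_iff.2 ⟨hle θ hθ θ' hθ', ?_⟩
      rw [dist_comm]
      exact hle θ' hθ' θ hθ
  -- Deviation and Lipschitz constant are both half of those for a query, so the exponent is the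
  -- same.
  have h := hE _ K (by rwa [← NNReal.coe_pos, hKeq]) hlip (τ / 2) (by positivity)
  refine h.trans_eq ?_
  rw [hKeq]
  congr 3
  field_simp

/-- No fixed hypothesis is close to many output distributions of the ensemble. -/
theorem measureReal_ball_le (E : LindbladianEnsemble n X M δ C_G) {t κ τ ε : ℝ} (ht : 0 < t)
    (hδ : 0 < δ) (hC : 0 < C_G) (hτ : 0 < τ) (hE : LevyConcentration κ E.Θ)
    (hmean : 2 * ε + τ ≤ E.meanTV t) (R : X → ℝ) :
    E.μ.real {θ | tvDist R (E.outDist t θ) < ε} ≤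
      2 * Real.exp (-(κ * τ ^ 2 / (t * δ * C_G) ^ 2 * M)) := by
  -- If `R` is far from the average `Q`, any `P` within `ε` of `R` differs from `Q` by more than `τ`
  -- on the sign query of `R - Q`. If `R` is near `Q`, such a `P` has distance below `2 * ε + τ / 2`
  -- from `Q`, at least `τ / 2` under the mean.
  rcases le_or_gt (ε + τ / 2) (tvDist R (E.avgDist t)) with hD | hD
  · obtain ⟨φ, hφ⟩ := exists_query_expect_sub_eq R (E.avgDist t)
    refine (measureReal_mono fun θ hθ ↦ ?_).trans (E.measureReal_query_le ht hδ hC hτ hE φ)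
    have h1 := (le_abs_self _).trans (abs_expect_sub_le R (E.outDist t θ) φ)
    have h2 : tvDist R (E.outDist t θ) < ε := hθ
    refine le_trans ?_ (le_abs_self (expect (E.outDist t θ) φ - expect (E.avgDist t) φ))
    linarith
  · refine (measureReal_mono fun θ hθ ↦ ?_).trans (E.measureReal_tvDist_le ht hδ hC hτ hE)
    have h1 := tvDist_triangle (E.outDist t θ) R (E.avgDist t)
    have h2 : tvDist R (E.outDist t θ) < ε := hθ
    rw [tvDist_comm] at h2
    refine le_trans ?_ (neg_le_abs (tvDist (E.outDist t θ) (E.avgDist t) - E.meanTV t))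
    linarith

end LindbladianEnsemble

/-- From a success measure at most `(q + 1) η` to a lower bound on the number of queries. -/
theorem mul_exp_le_of_le_succ_mul {b x : ℝ} {q : ℕ} (hη : 2 * Real.exp (-x) < b)
    (h : b ≤ (q + 1) * (2 * Real.exp (-x))) : 1 / 4 * b * Real.exp x ≤ q := by
  have hpos := Real.exp_pos (-x)
  -- `q = 0` would contradict `hη`; hence `q + 1 ≤ 2 * q`, which produces the factor `1 / 4`.
  have hq : (1 : ℝ) ≤ q := by
    rcases Nat.eq_zero_or_pos q with rfl | hq
    · norm_num at h
      linarith
    · exact_mod_cast hq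
  have hb : b ≤ 4 * q * Real.exp (-x) := by nlinarith
  calc 1 / 4 * b * Real.exp x ≤ 1 / 4 * (4 * q * Real.exp (-x)) * Real.exp x := by gcongr
    _ = q * (Real.exp (-x) * Real.exp x) := by ring
    _ = q := by rw [← Real.exp_add]; simp

theorem mainTheorem4 :
    -- Lévy concentration holds, with an absolute constant, when `Θ` has full measure in the sphere
    (∃ κ : ℝ, 0 < κ ∧ ∀ M : ℕ, 1 ≤ M → ∀ Θ : Set (ParamSphere M), MeasurableSet Θ →
      surfaceMeasure M Θᶜ = 0 → LevyConcentration κ Θ) ∧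
    -- the lower bounds, for all ensembles with Lévy concentration and the mean TV assumption
    ∀ (t δ C_G κ m₀ ε τ α β : ℝ) (εmean : ℕ → ℝ),
      0 < t → 0 < δ → 0 < C_G → 0 < κ → 0 < m₀ → 0 < ε → 0 < τ → 2 * ε + τ < m₀ →
      1 / 2 < α → 0 < β → Tendsto εmean atTop (𝓝 0) →
      ∀ᶠ M : ℕ in atTop,
        ∀ (n X : Type*) [Fintype n] [DecidableEq n] [Fintype X]
          (E : LindbladianEnsemble n X M δ C_G),
          LevyConcentration κ E.Θ →
          |E.meanTV t - m₀| ≤ εmean M →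
          (∀ (q : ℕ) (A : SQAlgorithm X),
            β ≤ E.μ.real {θ | SQAlgorithm.Learns A ε τ q (E.outDist t θ)} →
            1 / 8 * β * Real.exp (κ * τ ^ 2 / (t * δ * C_G) ^ 2 * M) ≤ q) ∧
          (∀ (q : ℕ) (Ω : Type*) [MeasurableSpace Ω] (ℙ : Measure Ω) [IsProbabilityMeasure ℙ]
            (A : RandomizedSQAlgorithm Ω X),
            β ≤ E.μ.real {θ | A.Learns ℙ α ε τ q (E.outDist t θ)} →
            1 / 8 * (α - 1 / 2) * β * Real.exp (κ * τ ^ 2 / (t * δ * C_G) ^ 2 * M) ≤ q) := by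
  refine ⟨⟨_, div_pos (pow_pos gaussianAbsMoment_pos 2) (by positivity), fun M hM Θ _ h0 ↦
    levyConcentration_of_measure_compl_eq_zero hM h0⟩, ?_⟩
  intro t δ C_G κ m₀ ε τ α β εmean ht hδ hC hκ _ hε hτ hm hα hβ hlim
  have hc : 0 < κ * τ ^ 2 / (t * δ * C_G) ^ 2 := by positivity
  have hexp : Tendsto (fun M : ℕ ↦ 2 * Real.exp (-(κ * τ ^ 2 / (t * δ * C_G) ^ 2 * M))) atTop
      (𝓝 0) := by
    have h1 : Tendsto (fun M : ℕ ↦ κ * τ ^ 2 / (t * δ * C_G) ^ 2 * (M : ℝ)) atTop atTop :=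
      tendsto_natCast_atTop_atTop.const_mul_atTop hc
    simpa using (Real.tendsto_exp_neg_atTop_nhds_zero.comp h1).const_mul 2
  -- The threshold `β / 2` serves both cases: it lies below `β`, and below `α * β` because `α > 1 /
  -- 2`.
  filter_upwards [hlim.eventually_le_const (sub_pos.2 hm),
    hexp.eventually_lt_const (half_pos hβ)] with M hM hη
  intro n X _ _ _ E hE hmean
  have hmean' : 2 * ε + τ ≤ E.meanTV t := by
    have := (abs_le.1 hmean).1
    linarith
  have hquery : ∀ φ : Query X,
      E.μ.real {θ | τ < |expect (E.outDist t θ) φ - expect (E.avgDist t) φ|} ≤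
        2 * Real.exp (-(κ * τ ^ 2 / (t * δ * C_G) ^ 2 * M)) := fun φ ↦
    (measureReal_mono (Set.ofPred_subset_ofPred.2 fun _ hθ ↦ hθ.le)).trans
      (E.measureReal_query_le ht hδ hC hτ hE φ)
  have hball : ∀ R : stdSimplex ℝ X, E.μ.real {θ | tvDist R.1 (E.outDist t θ) < ε} ≤
      2 * Real.exp (-(κ * τ ^ 2 / (t * δ * C_G) ^ 2 * M)) := fun R ↦
    E.measureReal_ball_le ht hδ hC hτ hE hmean' R.1
  refine ⟨fun q A hA ↦ ?_, fun q Ω _ ℙ _ A hA ↦ ?_⟩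
  · have h := mul_exp_le_of_le_succ_mul (by linarith)
      (hA.trans (A.measureReal_learns_le (by positivity) hτ.le hquery hball q))
    refine le_trans ?_ h
    gcongr
    norm_num
  · have hαβ : α * β ≤ (q + 1) * (2 * Real.exp (-(κ * τ ^ 2 / (t * δ * C_G) ^ 2 * M))) :=
      (mul_le_mul_of_nonneg_left hA (by linarith)).trans
        (A.mul_measureReal_learns_le (fun x ↦ (E.continuous_outDist t x).measurable)
          (by positivity) hτ.le (by linarith) hquery hball q)
    have h := mul_exp_le_of_le_succ_mul (by nlinarith) hαβ
    refine le_trans ?_ h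
    gcongr ?_ * _
    -- The argument gives `1 / 4 * (α * β)`, which exceeds the claimed constant.
    nlinarith
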